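/- Let $d\ge 2$, and let $SUM_d$ be the two-qudit gate $|a\rangle|b\rangle\mapsto|a\rangle|a+b \bmod d\rangle$. Consider quantum circuits on $n\ge 1$ data qudits and $m\ge 0$ ancillary qudits, all of dimension $d$, built from $SUM_d$ gates (on arbitrary ordered pairs of distinct qudits) and arbitrary single-qudit unitary gates. The size of a circuit is its number of gates; its depth is its number of layers, where the gates in one layer act on pairwise disjoint sets of qudits. Such a circuit implements an $n$-qudit unitary $U$ if it maps $|\psi\rangle|0\rangle^{\otimes m}$ to $(U|\psi\rangle)|0\rangle^{\otimes m}$ for every $n$-qudit state $|\psi\rangle$. (1) There is an absolute constant $C>0$ such that, for all $d\ge2$, $n\ge1$, $m\ge0$, every $n$-qudit diagonal unitary is implemented by such a circuit with $m$ ancillary qudits whose depth is at most $C\left(\frac{d^{n-1}}{n+m}+n\log d\right)$ and whose size is at most $C\,d^{n-1}$. (2) For fixed $d$ these bounds are asymptotically optimal: for every $d\ge 2$ there is a constant $\kappa_d>0$ such that, for all $n\ge1$ and $m\ge0$, there is an $n$-qudit diagonal unitary such that every such circuit with $m$ ancillary qudits that implements it has depth at least $\kappa_d\left(\frac{d^{n-1}}{n+m}+n\log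 d\right)$ and size at least $\kappa_d\,d^{n-1}$. -/

import Mathlib

noncomputable section

namespace Qudit

/-- Labels of the computational basis of a register of `d`-level systems with wires `W`. -/
abbrev BasisState (d : ℕ) (W : Type) : Type := W → ZMod d

/-- Elementary gates: an arbitrary single-qudit unitary on the wire `w`, or the gate `SUM_d` with
control `a` and target `b`. -/
inductive Gate (d : ℕ) [NeZero d] (W : Type) : Type
  | single (w : W) (u : Matrix.unitaryGroup (ZMod d) ℂ) : Gate d W
  | sum (a b : W) (hab : a ≠ b) : Gate d W

namespace Gate

variable {d : ℕ} [NeZero d] {W : Type} [DecidableEq W]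

/-- The wires on which a gate acts. -/
def support : Gate d W → Finset W
  | single w _ => {w}
  | sum a b _ => {a, b}

/-- The matrix of a gate on the whole register (row `y`, column `x`); `SUM_d` maps the basis state
`x` to the one obtained by replacing `x b` by `x a + x b` modulo `d`. -/
def toMatrix [Fintype W] : Gate d W → Matrix (BasisState d W) (BasisState d W) ℂ
  | single w u => fun y x => if ∀ v, v ≠ w → y v = x v then u.1 (y w) (x w) else 0
  | sum a b _ => fun y x => if y = Function.update x b (x a + x b) then 1 else 0

end Gate

/-- A layer: gates acting on pairwise disjoint sets of wires, executed in one time step. -/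
structure Layer (d : ℕ) [NeZero d] (W : Type) [DecidableEq W] : Type where
  gates : List (Gate d W)
  disjoint : gates.Pairwise fun g h => Disjoint g.support h.support

/-- The matrix of a layer: the product of its (commuting) gates. -/
def Layer.toMatrix {d : ℕ} [NeZero d] {W : Type} [DecidableEq W] [Fintype W] (l : Layer d W) :
    Matrix (BasisState d W) (BasisState d W) ℂ :=
  (l.gates.map Gate.toMatrix).prod

/-- A circuit: its layers, in the order of execution. -/
abbrev Circuit (d : ℕ) [NeZero d] (W : Type) [DecidableEq W] : Type := List (Layer d W)

namespace Circuit

variable {d : ℕ} [NeZero d] {W : Type} [DecidableEq W]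

/-- The number of layers. -/
def depth (c : Circuit d W) : ℕ := c.length

/-- The total number of gates. -/
def size (c : Circuit d W) : ℕ := (c.map fun l => l.gates.length).sum

/-- The matrix of a circuit; the first layer of the list acts first. -/
def toMatrix [Fintype W] : Circuit d W → Matrix (BasisState d W) (BasisState d W) ℂ
  | [] => 1
  | l :: c => toMatrix c * l.toMatrix

end Circuit

/-- The vector `ψ ⊗ |0…0⟩`: `n` data qudits in the state `ψ`, `m` ancillary qudits in the state
zero. -/
def withAncilla {d n : ℕ} (m : ℕ) (ψ : BasisState d (Fin n) → ℂ) :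
    BasisState d (Fin n ⊕ Fin m) → ℂ :=
  fun z => if ∀ j : Fin m, z (Sum.inr j) = 0 then ψ fun i => z (Sum.inl i) else 0

/-- The circuit, on `n` data and `m` ancillary qudits, implements the `n`-qudit operator `U`: it
maps `ψ ⊗ |0…0⟩` to `U ψ ⊗ |0…0⟩`, so the ancillary qudits start and end in the state zero. -/
def Circuit.Implements {d n m : ℕ} [NeZero d] (c : Circuit d (Fin n ⊕ Fin m))
    (U : Matrix (BasisState d (Fin n)) (BasisState d (Fin n)) ℂ) : Prop :=
  ∀ ψ : BasisState d (Fin n) → ℂ,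
    (Circuit.toMatrix c).mulVec (withAncilla m ψ) = withAncilla m (U.mulVec ψ)

/-- `U` is a diagonal unitary. -/
def IsDiagonalUnitary {d n : ℕ} [NeZero d]
    (U : Matrix (BasisState d (Fin n)) (BasisState d (Fin n)) ℂ) : Prop :=
  U.IsDiag ∧ U ∈ Matrix.unitaryGroup (BasisState d (Fin n)) ℂ

/-- The depth `d ^ (n - 1) / (n + m) + n log d` (used for `n ≥ 1` only). -/
def depthBound (d n m : ℕ) : ℝ :=
  (d : ℝ) ^ (n - 1) / ((n : ℝ) + (m : ℝ)) + (n : ℝ) * Real.log (d : ℝ)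

end Qudit

end

/-!
A diagonal unitary is `exp (i f)` for a real function `f` of the data, and the theorem says how
cheaply such phases are applied, and that a generic one admits nothing cheaper.

**Words.** A wire holding `y + ∑ l, p l (x l)`, the sum of a leading letter and of functions of
other wires, lets a single-qudit gate apply the phase `h (y + ∑ l, p l (x l))`. Fourier analysis in
the leading letter reduces `f` to such phases, up to a function that does not depend on `y`, as soon
as the characters of the words span the functions of `x` (`Complete`, `Complete.leading`). A family
of `d` functions of one letter suffices for each `l`, and its members are added to a wire by `SUM`
gates and single-qudit permutations (`IsCheap`, `exists_complete_cheap`). Hence about `d ^ (n - 1)`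
words are needed for `n` wires, as many as the bound on the size permits, but each of them must cost
only `O(1)` gates.

**Tables.** To this end a word is split into two halves. One job (`Phase.job`) loads `B` first
halves on wires `L a` and `B` second halves on wires `R b`, and then lets all `B ^ 2` pairs meet, a
wire `L a` and a wire `R b` at time `a + b`: with `B` proportional to `n` this is `B ^ 2` words in
depth `O(B)`. A table (`Phase.table`) distributes the jobs over groups of wires that work in
parallel.

**With ancillary wires** (`exists_circuit_ancilla`), each of `G` groups holds a copy of the data and
the wires of a table. The copies are made in depth `O(log G)`, which gives the term `n log d`; a
larger `G` than the one that balances the two terms is not used, so that the size stays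
`O(d ^ (n - 1))`. Each word needs a leading letter, so words with a leading letter at each possible
place are used (`exists_generating`).

**Without ancillary wires** (`Phase.of_dependsOn_in_place`), some data wires play the parts of the
wires `L` and `R`. What they already hold enters the argument of the phases; it is compensated for
one value `κ` of these wires at a time. A table is run, the leading wire `y` is incremented if the
wires `L`, `R` hold `κ`, the opposite table is run, and the increment is undone. All phases cancel
unless the wires hold `κ`, and what remains is a difference `h z - h (z + 1)`; every function with
vanishing mean is of this form (`exists_peel_in_place`). What is left of `f` does not depend on `y`,
and the costs of the recursion on the number of wires form a geometric series.

**Lower bound.** The entries of a product of `s` gates of given types are polynomials in `2 d² s`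
real parameters. There are countably many types, and countably many smooth images of spaces of
dimension less than `d ^ n` do not cover a ball of dimension `d ^ n`, since they have smaller
Hausdorff dimension. So some diagonal unitary needs `d ^ n ≤ 2 d² s` (`exists_generic`). This bounds
the size, and, as a layer has at most `n + m` gates, the depth. For the term `n log d`, only the at
most `n 2 ^ D` gates in the light cone of the data wires matter in a circuit of depth `D`: the other
gates can be executed last, and they multiply the diagonal entries by one common factor
(`exists_lightCone_entries`). The parameter count, with this factor as one more parameter, yields
`d ^ n ≤ 4 d² n 2 ^ D`.
-/

noncomputable section

namespace Qudit

set_option linter.unusedSectionVars false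

section

variable {d : ℕ} [NeZero d] {W : Type} [DecidableEq W] [Fintype W]

/-! ### Operators supported on a set of wires -/

/-- The matrix `M` is `m ⊗ 1` for some matrix `m` on the wires in `V`: it preserves the values of
the wires outside `V`, and its entries do not depend on these values. -/
def ActsOn (V : Finset W) (M : Matrix (BasisState d W) (BasisState d W) ℂ) : Prop :=
  (∀ y x, M y x ≠ 0 → ∀ v ∉ V, y v = x v) ∧
  ∀ y x y' x', (∀ v ∈ V, y v = y' v ∧ x v = x' v) → (∀ v ∉ V, y v = x v) →
    (∀ v ∉ V, y' v = x' v) → M y x = M y' x'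

theorem update_eq_iff_of_ne {a b : W} (hab : a ≠ b) (y x : BasisState d W) :
    y = Function.update x b (x a + x b) ↔
      (∀ v, v ∉ ({a, b} : Finset W) → y v = x v) ∧ y a = x a ∧ y b = x a + x b := by
  constructor
  · rintro rfl
    refine ⟨fun v hv => ?_, ?_, by simp⟩
    · simp only [Finset.mem_insert, Finset.mem_singleton, not_or] at hv
      simp [Function.update_of_ne hv.2]
    · simp [Function.update_of_ne hab]
  · rintro ⟨h1, h2, h3⟩
    funext v
    by_cases hb : v = b
    · subst hb; simpa using h3
    · rw [Function.update_of_ne hb]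
      by_cases ha : v = a
      · subst ha; exact h2
      · exact h1 v (by simp [ha, hb])

theorem Gate.actsOn (g : Gate d W) : ActsOn g.support g.toMatrix := by
  cases g with
  | single w u =>
    refine ⟨fun y x h v hv => ?_, fun y x y' x' h h1 h2 => ?_⟩
    · simp only [Gate.support, Finset.mem_singleton] at hv
      simp only [Gate.toMatrix] at h
      by_contra hne
      exact h (if_neg fun H => hne (H v hv))
    · simp only [Gate.support, Finset.mem_singleton, forall_eq] at h h1 h2
      simp only [Gate.toMatrix]
      rw [if_pos h1, if_pos h2, h.1, h.2]
  | sum a b hab =>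
    refine ⟨fun y x h v hv => ?_, fun y x y' x' h h1 h2 => ?_⟩
    · simp only [Gate.toMatrix] at h
      by_contra hne
      exact h (if_neg fun H => hne (((update_eq_iff_of_ne hab y x).1 H).1 v hv))
    · simp only [Gate.support] at h h1 h2
      have ha := h a (by simp)
      have hb := h b (by simp)
      have e : ∀ z w : BasisState d W, (∀ v ∉ ({a, b} : Finset W), z v = w v) →
          (z = Function.update w b (w a + w b) ↔ z a = w a ∧ z b = w a + w b) := fun z w hzw => by
        rw [update_eq_iff_of_ne hab]; exact ⟨fun H => H.2, fun H => ⟨hzw, H⟩⟩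
      have e' : y = Function.update x b (x a + x b) ↔ y' = Function.update x' b (x' a + x' b) := by
        rw [e y x h1, e y' x' h2, ha.1, ha.2, hb.1, hb.2]
      simp only [Gate.toMatrix, e']

theorem ActsOn.mul_apply {V V' : Finset W} (hV : Disjoint V V')
    {M N : Matrix (BasisState d W) (BasisState d W) ℂ} (hM : ActsOn V M) (hN : ActsOn V' N)
    (y x : BasisState d W) :
    (M * N) y x = M y (fun v => if v ∈ V then x v else y v) *
      N (fun v => if v ∈ V then x v else y v) x := by
  rw [Matrix.mul_apply]
  refine Finset.sum_eq_single _ (fun z _ hz => ?_) (by simp)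
  by_contra hne
  refine hz (funext fun v => ?_)
  have h1 := hM.1 y z (left_ne_zero_of_mul hne) v
  have h2 := hN.1 z x (right_ne_zero_of_mul hne) v
  by_cases hv : v ∈ V
  · simp only [hv, if_true]
    exact h2 (Finset.disjoint_left.1 hV hv)
  · simp only [hv, if_false]
    exact (h1 hv).symm

theorem ActsOn.commute {V V' : Finset W} (hV : Disjoint V V')
    {M N : Matrix (BasisState d W) (BasisState d W) ℂ} (hM : ActsOn V M) (hN : ActsOn V' N) :
    Commute M N := by
  refine Matrix.ext fun y x => ?_
  rw [hM.mul_apply hV hN, hN.mul_apply hV.symm hM]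
  by_cases hyx : ∀ v, v ∉ V → v ∉ V' → y v = x v
  · rw [mul_comm]
    congr 1
    · refine hN.2 _ _ _ _ (fun v hv => ?_) (fun v hv => ?_) (fun v hv => ?_)
      · simp [hv, Finset.disjoint_right.1 hV hv]
      · by_cases h : v ∈ V <;> simp [h, hyx v, hv]
      · simp [hv]
    · refine hM.2 _ _ _ _ (fun v hv => ?_) (fun v hv => ?_) (fun v hv => ?_)
      · simp [hv, Finset.disjoint_left.1 hV hv]
      · simp [hv]
      · by_cases h : v ∈ V' <;> simp [h, hyx v, hv]
  · push Not at hyx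
    obtain ⟨v, h1, h2, h3⟩ := hyx
    have e1 : M y (fun v => if v ∈ V then x v else y v) *
      N (fun v => if v ∈ V then x v else y v) x = 0 := by
      by_contra hne
      have := hN.1 _ _ (right_ne_zero_of_mul hne) v h2
      simp [h1] at this
      exact h3 this
    have e2 : N y (fun v => if v ∈ V' then x v else y v) *
      M (fun v => if v ∈ V' then x v else y v) x = 0 := by
      by_contra hne
      have := hM.1 _ _ (right_ne_zero_of_mul hne) v h1
      simp [h2] at this
      exact h3 this
    rw [e1, e2]

theorem Gate.commute {g h : Gate d W} (H : Disjoint g.support h.support) :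
    Commute g.toMatrix h.toMatrix :=
  g.actsOn.commute H h.actsOn

theorem Layer.toMatrix_commute {l l' : Layer d W}
    (H : ∀ g ∈ l.gates, ∀ h ∈ l'.gates, Disjoint g.support h.support) :
    Commute l.toMatrix l'.toMatrix := by
  refine Commute.list_prod_left _ _ fun x hx => Commute.list_prod_right _ _ fun y hy => ?_
  obtain ⟨g, hg, rfl⟩ := List.mem_map.1 hx
  obtain ⟨h, hh, rfl⟩ := List.mem_map.1 hy
  exact Gate.commute (H g hg h hh)

theorem Circuit.toMatrix_append (c c' : Circuit d W) :
    Circuit.toMatrix (c ++ c') = Circuit.toMatrix c' * Circuit.toMatrix c := by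
  induction c with
  | nil => simp [Circuit.toMatrix]
  | cons l c ih => simp only [List.cons_append, Circuit.toMatrix, ih, mul_assoc]

/-- All gates of the circuit act inside `V`. -/
def Circuit.SupportedOn (c : Circuit d W) (V : Finset W) : Prop :=
  ∀ l ∈ c, ∀ g ∈ l.gates, g.support ⊆ V

theorem Circuit.commute_layer {c : Circuit d W} {l : Layer d W} {V V' : Finset W}
    (hV : Disjoint V V') (hc : Circuit.SupportedOn c V) (hl : ∀ g ∈ l.gates, g.support ⊆ V') :
    Commute (Circuit.toMatrix c) l.toMatrix := by
  induction c with
  | nil => simp [Circuit.toMatrix, Commute.one_left]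
  | cons l' c ih =>
    rw [Circuit.toMatrix]
    refine Commute.mul_left (ih fun m hm => hc m (List.mem_cons_of_mem _ hm)) ?_
    refine Layer.toMatrix_commute fun g hg h hh => ?_
    exact Disjoint.mono (hc l' List.mem_cons_self g hg) (hl h hh) hV

/-- Circuits on disjoint sets of wires can be run side by side. -/
theorem Circuit.exists_parallel {V V' : Finset W} (hV : Disjoint V V') :
    ∀ (c c' : Circuit d W), Circuit.SupportedOn c V → Circuit.SupportedOn c' V' →
      ∃ e : Circuit d W, e.length = max c.length c'.length ∧
        Circuit.SupportedOn e (V ∪ V') ∧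
        Circuit.toMatrix e = Circuit.toMatrix c * Circuit.toMatrix c'
  | [], c', _, h' => ⟨c', by simp, fun l hl g hg => (h' l hl g hg).trans Finset.subset_union_right,
      by simp [Circuit.toMatrix]⟩
  | l :: c, [], h, _ => ⟨l :: c, by simp,
      fun l hl g hg => (h l hl g hg).trans Finset.subset_union_left, by simp [Circuit.toMatrix]⟩
  | l :: c, l' :: c', h, h' => by
    have hc : Circuit.SupportedOn c V := fun m hm => h m (List.mem_cons_of_mem _ hm)
    have hc' : Circuit.SupportedOn c' V' := fun m hm => h' m (List.mem_cons_of_mem _ hm)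
    obtain ⟨e, he1, he2, he3⟩ := Circuit.exists_parallel hV c c' hc hc'
    refine ⟨⟨l.gates ++ l'.gates, List.pairwise_append.2 ⟨l.disjoint, l'.disjoint,
      fun g hg k hk => Disjoint.mono (h l List.mem_cons_self g hg)
        (h' l' List.mem_cons_self k hk) hV⟩⟩ :: e, by simp [he1], ?_, ?_⟩
    · intro m hm g hg
      rcases List.mem_cons.1 hm with rfl | hm
      · rcases List.mem_append.1 hg with hg | hg
        · exact (h l List.mem_cons_self g hg).trans Finset.subset_union_left
        · exact (h' l' List.mem_cons_self g hg).trans Finset.subset_union_right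
      · exact he2 m hm g hg
    · have hcomm := Circuit.commute_layer hV.symm hc' (h l List.mem_cons_self)
      simp only [Circuit.toMatrix, he3]
      have : (⟨l.gates ++ l'.gates, List.pairwise_append.2 ⟨l.disjoint, l'.disjoint,
        fun g hg k hk => Disjoint.mono (h l List.mem_cons_self g hg)
        (h' l' List.mem_cons_self k hk) hV⟩⟩ : Layer d W).toMatrix = l.toMatrix * l'.toMatrix := by
        simp [Layer.toMatrix]
      rw [this, mul_assoc, ← mul_assoc (Circuit.toMatrix c'), hcomm.eq]
      simp only [mul_assoc]

/-! ### Matrices realized in a given depth on a given set of wires -/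

/-- The matrix `M` is the matrix of a circuit of depth at most `D` on the wires in `V`. -/
def Realizes (D : ℕ) (V : Finset W) (M : Matrix (BasisState d W) (BasisState d W) ℂ) : Prop :=
  ∃ c : Circuit d W, c.length ≤ D ∧ Circuit.SupportedOn c V ∧ Circuit.toMatrix c = M

theorem Realizes.mono {D D' : ℕ} {V V' : Finset W}
    {M : Matrix (BasisState d W) (BasisState d W) ℂ} (h : Realizes D V M) (hD : D ≤ D')
    (hV : V ⊆ V') : Realizes D' V' M := by
  obtain ⟨c, h1, h2, h3⟩ := h
  exact ⟨c, h1.trans hD, fun l hl g hg => (h2 l hl g hg).trans hV, h3⟩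

theorem Realizes.one (V : Finset W) :
    Realizes 0 V (1 : Matrix (BasisState d W) (BasisState d W) ℂ) :=
  ⟨[], by simp, fun l hl => by simp at hl, rfl⟩

/-- The factor on the right acts first. -/
theorem Realizes.mul {D D' : ℕ} {V : Finset W} {M M' : Matrix (BasisState d W) (BasisState d W) ℂ}
    (h' : Realizes D' V M') (h : Realizes D V M) : Realizes (D + D') V (M' * M) := by
  obtain ⟨c, h1, h2, h3⟩ := h
  obtain ⟨c', h1', h2', h3'⟩ := h'
  refine ⟨c ++ c', by simpa using add_le_add h1 h1', fun l hl => ?_, ?_⟩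
  · rcases List.mem_append.1 hl with hl | hl
    exacts [h2 l hl, h2' l hl]
  · rw [Circuit.toMatrix_append, h3, h3']

theorem Realizes.parallel {D : ℕ} {V V' : Finset W} (hV : Disjoint V V')
    {M M' : Matrix (BasisState d W) (BasisState d W) ℂ} (h : Realizes D V M)
    (h' : Realizes D V' M') : Realizes D (V ∪ V') (M * M') := by
  obtain ⟨c, h1, h2, h3⟩ := h
  obtain ⟨c', h1', h2', h3'⟩ := h'
  obtain ⟨e, e1, e2, e3⟩ := Circuit.exists_parallel hV c c' h2 h2'
  exact ⟨e, by simp [e1, h1, h1'], e2, by rw [e3, h3, h3']⟩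

theorem Realizes.gate (g : Gate d W) : Realizes 1 g.support g.toMatrix :=
  ⟨[⟨[g], List.pairwise_singleton _ _⟩], by simp, by simp [Circuit.SupportedOn],
    by simp [Circuit.toMatrix, Layer.toMatrix]⟩

/-! ### Monomial matrices -/

/-- The monomial matrix that maps the basis state `s` to `exp (i f s)` times the basis state
`σ s`. -/
def monomial (σ : Equiv.Perm (BasisState d W)) (f : BasisState d W → ℝ) :
    Matrix (BasisState d W) (BasisState d W) ℂ :=
  fun y x => if y = σ x then Complex.exp (f x * Complex.I) else 0

theorem monomial_mul (σ τ : Equiv.Perm (BasisState d W)) (f g : BasisState d W → ℝ) :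
    monomial τ g * monomial σ f = monomial (τ * σ) (fun s => f s + g (σ s)) := by
  refine Matrix.ext fun y x => ?_
  rw [Matrix.mul_apply, Finset.sum_eq_single (σ x)]
  · by_cases h : y = τ (σ x)
    · have h' : y = (τ * σ) x := h
      simp only [monomial]
      rw [if_pos h, if_pos h', if_pos trivial, ← Complex.exp_add]; push_cast; congr 1; ring
    · have h' : ¬ y = (τ * σ) x := h
      simp only [monomial]
      rw [if_neg h, if_neg h', zero_mul]
  · intro z _ hz
    simp [monomial, hz]
  · simp

theorem monomial_one_zero : monomial (1 : Equiv.Perm (BasisState d W)) (fun _ => 0) = 1 := by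
  refine Matrix.ext fun y x => ?_
  simp [monomial, Matrix.one_apply]

theorem wire_le_mul {M : Matrix (BasisState d W) (BasisState d W) ℂ} {w : W}
    (u : Matrix.unitaryGroup (ZMod d) ℂ) (y x : BasisState d W) :
    ((Gate.single w u).toMatrix * M) y x = ∑ k, u.1 (y w) k * M (Function.update y w k) x := by
  rw [Matrix.mul_apply]
  symm
  refine Finset.sum_of_injOn (fun k => Function.update y w k) ?_ (by simp) ?_ ?_
  · intro k _ k' _ h
    exact Function.update_injective y w h
  · intro z _ hz
    simp only [Gate.toMatrix]
    rw [if_neg, zero_mul]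
    intro H
    refine hz ⟨z w, by simp, funext fun v => ?_⟩
    by_cases hv : v = w
    · subst hv; simp
    · simp [hv, H v hv]
  · intro k _
    simp +contextual [Gate.toMatrix, Function.update_of_ne]

theorem single_mul_single (w : W) (u v : Matrix.unitaryGroup (ZMod d) ℂ) :
    (Gate.single w u).toMatrix * (Gate.single w v).toMatrix = (Gate.single w (u * v)).toMatrix := by
  refine Matrix.ext fun y x => ?_
  rw [wire_le_mul]
  have : ∀ k, (∀ a, a ≠ w → Function.update y w k a = x a) ↔ ∀ a, a ≠ w → y a = x a := by
    intro k
    refine forall_congr' fun a => forall_congr' fun h => ?_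
    rw [Function.update_of_ne h]
  simp only [Gate.toMatrix, this, Function.update_self]
  split_ifs
  · simp [Matrix.mul_apply]
  · simp

theorem single_one (w : W) : (Gate.single w (1 : Matrix.unitaryGroup (ZMod d) ℂ)).toMatrix = 1 := by
  refine Matrix.ext fun y x => ?_
  simp only [Gate.toMatrix, Matrix.one_apply, OneMemClass.coe_one]
  by_cases h : y = x
  · simp [h]
  · rw [if_neg h]
    split_ifs with h1 h2
    · refine absurd (funext fun v => ?_) h
      by_cases hv : v = w
      · rw [hv, h2]
      · exact h1 v hv
    · rfl
    · rfl

/-- A permutation of the levels of the wire `w`. -/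
def wirePerm (w : W) (π : Equiv.Perm (ZMod d)) : Equiv.Perm (BasisState d W) where
  toFun s := Function.update s w (π (s w))
  invFun s := Function.update s w (π.symm (s w))
  left_inv s := by simp
  right_inv s := by simp

/-- The addition of the wire `a` to the wire `b`. -/
def sumPerm (a b : W) (hab : a ≠ b) : Equiv.Perm (BasisState d W) where
  toFun s := Function.update s b (s a + s b)
  invFun s := Function.update s b (s b - s a)
  left_inv s := by simp [Function.update_of_ne hab]
  right_inv s := by simp [Function.update_of_ne hab]

theorem Realizes.sumPerm (a b : W) (hab : a ≠ b) :
    Realizes 1 {a, b} (monomial (d := d) (sumPerm a b hab) (fun _ => 0)) := by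
  have : monomial (d := d) (Qudit.sumPerm a b hab) (fun _ => 0) = (Gate.sum a b hab).toMatrix := by
    refine Matrix.ext fun y x => ?_
    simp [monomial, Gate.toMatrix, Qudit.sumPerm]
  rw [this]
  exact Realizes.gate (Gate.sum a b hab)

/-- A monomial unitary on one wire. -/
theorem Realizes.wire (w : W) (π : Equiv.Perm (ZMod d)) (g : ZMod d → ℝ) :
    Realizes 1 {w} (monomial (wirePerm w π) (fun s => g (s w))) := by
  have hu : (Matrix.of fun y x : ZMod d =>
      if y = π x then Complex.exp (g x * Complex.I) else 0) ∈
      Matrix.unitaryGroup (ZMod d) ℂ := by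
    rw [Matrix.mem_unitaryGroup_iff']
    refine Matrix.ext fun y x => ?_
    rw [Matrix.mul_apply, Matrix.star_eq_conjTranspose, Finset.sum_eq_single (π x)]
    · simp only [Matrix.conjTranspose_apply, Matrix.of_apply, if_true, EmbeddingLike.apply_eq_iff_eq,
        Matrix.one_apply]
      by_cases h : y = x
      · subst h
        simp only [if_true]
        rw [RCLike.star_def, ← Complex.exp_conj, ← Complex.exp_add]
        simp
      · simp [h, Ne.symm h]
    · intro z _ hz
      simp [hz]
    · simp
  have : monomial (wirePerm w π) (fun s => g (s w)) = (Gate.single w ⟨_, hu⟩).toMatrix := by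
    refine Matrix.ext fun y x => ?_
    simp only [monomial, Gate.toMatrix, Matrix.of_apply]
    by_cases h : ∀ v, v ≠ w → y v = x v
    · have e : y = wirePerm w π x ↔ y w = π (x w) := by
        refine ⟨fun H => by simp [H, wirePerm], fun H => funext fun v => ?_⟩
        by_cases hv : v = w
        · subst hv; simp [H, wirePerm]
        · simp [hv, h v hv, wirePerm]
      simp only [if_pos h, e]
    · rw [if_neg h, if_neg]
      rintro rfl
      exact h fun v hv => by simp [hv, wirePerm]
  rw [this]
  exact Realizes.gate (Gate.single w ⟨_, hu⟩)

theorem wirePerm_one (w : W) : wirePerm w (1 : Equiv.Perm (ZMod d)) = 1 := by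
  ext s v
  simp [wirePerm]

/-! ### Inverse circuits -/

/-- The inverse of `SUM` is `SUM` conjugated by the negation of the target. -/
theorem Gate.exists_inverse (g : Gate d W) :
    ∃ M, Realizes 3 g.support M ∧ M * g.toMatrix = 1 := by
  cases g with
  | single w u =>
    refine ⟨(Gate.single w u⁻¹).toMatrix, (Realizes.gate _).mono (by norm_num) le_rfl, ?_⟩
    rw [single_mul_single, inv_mul_cancel, single_one]
  | sum a b hab =>
    have hn := (Realizes.wire b (Equiv.neg (ZMod d)) (fun _ => 0)).mono le_rfl
      (show {b} ⊆ ({a, b} : Finset W) by simp)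
    refine ⟨_, (hn.mul ((Realizes.sumPerm (d := d) a b hab).mul hn)), ?_⟩
    have : (Gate.sum a b hab).toMatrix = monomial (d := d) (sumPerm a b hab) (fun _ => 0) := by
      refine Matrix.ext fun y x => ?_
      simp [monomial, Gate.toMatrix, Qudit.sumPerm]
    rw [this, monomial_mul, monomial_mul, monomial_mul, ← monomial_one_zero]
    simp only [add_zero]
    congr 1
    ext s v
    by_cases hv : v = b
    · subst hv; simp [wirePerm, Qudit.sumPerm, Function.update_of_ne hab]
    · simp [wirePerm, Qudit.sumPerm, hv]

theorem Layer.exists_inverse : ∀ (gs : List (Gate d W)),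
    (gs.Pairwise fun g h => Disjoint g.support h.support) → ∀ V : Finset W,
    (∀ g ∈ gs, g.support ⊆ V) → ∃ M, Realizes 3 V M ∧ M * (gs.map Gate.toMatrix).prod = 1
  | [], _, V, _ => ⟨1, (Realizes.one V).mono (by norm_num) le_rfl, by simp⟩
  | g :: gs, hgs, V, hV => by
    rw [List.pairwise_cons] at hgs
    obtain ⟨M, hM, hM1⟩ := g.exists_inverse
    obtain ⟨N, hN, hN1⟩ := Layer.exists_inverse gs hgs.2 (V \ g.support) fun h hh =>
      Finset.subset_sdiff.2 ⟨hV h (List.mem_cons_of_mem _ hh), (hgs.1 h hh).symm⟩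
    refine ⟨N * M, (hN.parallel Finset.sdiff_disjoint hM).mono le_rfl ?_, ?_⟩
    · exact Finset.union_subset Finset.sdiff_subset (hV g List.mem_cons_self)
    · rw [List.map_cons, List.prod_cons, mul_assoc, ← mul_assoc M, hM1, one_mul, hN1]

theorem Realizes.exists_inverse {D : ℕ} {V : Finset W}
    {M : Matrix (BasisState d W) (BasisState d W) ℂ} (h : Realizes D V M) :
    ∃ N, Realizes (3 * D) V N ∧ N * M = 1 := by
  obtain ⟨c, h1, h2, rfl⟩ := h
  suffices H : ∃ N, Realizes (3 * c.length) V N ∧ N * Circuit.toMatrix c = 1 by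
    obtain ⟨N, hN, hN1⟩ := H
    exact ⟨N, hN.mono (by omega) le_rfl, hN1⟩
  clear h1
  induction c with
  | nil => exact ⟨1, Realizes.one V, by simp [Circuit.toMatrix]⟩
  | cons l c ih =>
    obtain ⟨N, hN, hN1⟩ := ih fun m hm => h2 m (List.mem_cons_of_mem _ hm)
    obtain ⟨M, hM, hM1⟩ := Layer.exists_inverse l.gates l.disjoint V (h2 l List.mem_cons_self)
    refine ⟨M * N, (hM.mul hN).mono (by simp; omega) le_rfl, ?_⟩
    rw [Circuit.toMatrix, mul_assoc, ← mul_assoc N, hN1, one_mul]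
    exact hM1

theorem Realizes.inv {D : ℕ} {V : Finset W} {σ : Equiv.Perm (BasisState d W)}
    (h : Realizes D V (monomial σ fun _ => 0)) :
    Realizes (3 * D) V (monomial σ⁻¹ fun _ => 0) := by
  obtain ⟨N, hN, hN1⟩ := h.exists_inverse
  have : monomial σ⁻¹ (fun _ => 0) = N := by
    have h2 : monomial σ (fun _ => 0) * monomial σ⁻¹ (fun _ => 0) =
        (1 : Matrix (BasisState d W) (BasisState d W) ℂ) := by
      rw [monomial_mul, mul_inv_cancel, ← monomial_one_zero]; simp
    calc monomial σ⁻¹ (fun _ => 0) = (N * monomial σ fun _ => 0) * monomial σ⁻¹ (fun _ => 0) := by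
          rw [hN1, one_mul]
      _ = N := by rw [mul_assoc, h2, mul_one]
  rwa [this]

/-! ### Phases and shears -/

/-- The diagonal unitary with phases `exp (i f)` is realized in depth `D` on the wires `V`. -/
def Phase (D : ℕ) (V : Finset W) (f : BasisState d W → ℝ) : Prop :=
  Realizes D V (monomial 1 f)

/-- A map between basis states that is realized, without phases, in depth `D` on the wires `V`. -/
def Moves (D : ℕ) (V : Finset W) (σ : Equiv.Perm (BasisState d W)) : Prop :=
  Realizes D V (monomial σ fun _ => 0)

theorem Moves.mul {D D' : ℕ} {V : Finset W} {σ τ : Equiv.Perm (BasisState d W)}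
    (h' : Moves D' V τ) (h : Moves D V σ) : Moves (D + D') V (τ * σ) := by
  have := Realizes.mul h' h
  rw [monomial_mul] at this
  simpa [Moves] using this

theorem Moves.parallel {D : ℕ} {V V' : Finset W} (hV : Disjoint V V')
    {σ τ : Equiv.Perm (BasisState d W)}
    (h : Moves D V τ) (h' : Moves D V' σ) : Moves D (V ∪ V') (τ * σ) := by
  have := Realizes.parallel hV h h'
  rw [monomial_mul] at this
  simpa [Moves] using this

/-- The phases are applied to the moved state; undoing the move costs three times its depth. -/
theorem Phase.conj {D D' : ℕ} {V : Finset W} {σ : Equiv.Perm (BasisState d W)}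
    {f : BasisState d W → ℝ} (hσ : Moves D V σ) (hf : Phase D' V f) :
    Phase (4 * D + D') V (fun s => f (σ s)) := by
  have := (Realizes.inv hσ).mul (hf.mul hσ)
  rw [monomial_mul, monomial_mul] at this
  simp only [one_mul, inv_mul_cancel, zero_add, add_zero] at this
  exact Realizes.mono this (by omega) le_rfl

/-- The basis state `s` is moved to `s + A s`. -/
def Shear (D : ℕ) (V : Finset W) (A : BasisState d W → BasisState d W) : Prop :=
  ∃ σ : Equiv.Perm (BasisState d W), (∀ s, σ s = s + A s) ∧ Moves D V σ

/-- A property of an operation `m` being available in depth `D` on the wires `V`, where sums of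
operations can be performed one after the other and, on disjoint sets of wires, side by side. -/
structure Schedulable (W : Type) [DecidableEq W] {M : Type} [AddCommMonoid M]
    (P : ℕ → Finset W → M → Prop) : Prop where
  mono : ∀ {D D' V V' m}, P D V m → D ≤ D' → V ⊆ V' → P D' V' m
  zero : ∀ V, P 0 V 0
  add : ∀ {D D' V m m'}, P D V m → P D' V m' → P (D + D') V (m + m')
  parallel : ∀ {D V V' m m'}, Disjoint V V' → P D V m → P D V' m' → P D (V ∪ V') (m + m')

/-- Jobs with the time slots `τ` are run in `T` time slots if jobs with the same time slot use
disjoint sets of wires. -/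
theorem Schedulable.sum {M : Type} [AddCommMonoid M] {P : ℕ → Finset W → M → Prop}
    (hP : Schedulable W P) {J : Type} [Fintype J] {T c : ℕ} (τ : J → Fin T) (V : J → Finset W)
    (U : Finset W) (hU : ∀ j, V j ⊆ U) (hV : ∀ i j, i ≠ j → τ i = τ j → Disjoint (V i) (V j))
    (m : J → M) (h : ∀ j, P c (V j) (m j)) : P (T * c) U (∑ j, m j) := by
  classical
  -- All jobs of one time slot run side by side, the slots run one after the other.
  have slot : ∀ (t : Fin T) (I : Finset J), (∀ j ∈ I, τ j = t) →
      P c (I.biUnion V) (∑ j ∈ I, m j) := by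
    intro t I
    induction I using Finset.induction_on with
    | empty => intro _; simpa using hP.mono (hP.zero ∅) (Nat.zero_le c) le_rfl
    | insert i I hi ih =>
      intro hI
      rw [Finset.sum_insert hi, Finset.biUnion_insert]
      refine hP.parallel ?_ (h i) (ih fun j hj => hI j (Finset.mem_insert_of_mem hj))
      rw [Finset.disjoint_biUnion_right]
      intro j hj
      refine hV i j (fun e => hi (e ▸ hj)) ?_
      rw [hI i (Finset.mem_insert_self _ _), hI j (Finset.mem_insert_of_mem hj)]
  have all : ∀ K : Finset (Fin T), P (K.card * c) U (∑ t ∈ K, ∑ j with τ j = t, m j) := by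
    intro K
    induction K using Finset.induction_on with
    | empty => simpa using hP.zero U
    | insert t K ht ih =>
      rw [Finset.sum_insert ht, Finset.card_insert_of_notMem ht, add_comm K.card, add_mul, one_mul]
      refine hP.add (hP.mono (slot t _ fun j hj => (Finset.mem_filter.1 hj).2) le_rfl ?_) ih
      exact Finset.biUnion_subset.2 fun j _ => hU j
  simpa [Finset.sum_fiberwise] using all Finset.univ

/-- All pairs of one wire `α a` and one wire `β b` are served in `|A| + |B|` time slots: the pair
of the wires number `a` and `b` has its turn at time `a + b`. -/
theorem Schedulable.sum_pairs {M : Type} [AddCommMonoid M] {P : ℕ → Finset W → M → Prop}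
    (hP : Schedulable W P) {A B : Type} [Fintype A] [Fintype B] {c : ℕ} (α : A → W) (β : B → W)
    (hα : Function.Injective α) (hβ : Function.Injective β) (hαβ : ∀ a b, α a ≠ β b)
    (U : Finset W) (hUα : ∀ a, α a ∈ U) (hUβ : ∀ b, β b ∈ U)
    (m : A → B → M) (h : ∀ a b, P c {α a, β b} (m a b)) :
    P ((Fintype.card A + Fintype.card B) * c) U (∑ a, ∑ b, m a b) := by
  rw [← Fintype.sum_prod_type']
  let eA := Fintype.equivFin A
  let eB := Fintype.equivFin B
  refine hP.sum (J := A × B) (fun j => ⟨eA j.1 + eB j.2, by omega⟩) (fun j => {α j.1, β j.2}) U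
    (fun j => ?_) (fun i j hij ht => ?_) (fun j => m j.1 j.2) (fun j => h j.1 j.2)
  · simp [Finset.insert_subset_iff, hUα, hUβ]
  · simp only [Fin.mk.injEq] at ht
    have h1 : i.1 ≠ j.1 := fun e => hij (Prod.ext e (eB.injective (Fin.ext (by rw [e] at ht; omega))))
    have h2 : i.2 ≠ j.2 := fun e => hij (Prod.ext (eA.injective (Fin.ext (by rw [e] at ht; omega))) e)
    simp [hαβ, (hαβ _ _).symm, hα.ne h1.symm, hβ.ne h2.symm]

theorem Phase.schedulable : Schedulable W (Phase (d := d) (W := W)) where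
  mono := Realizes.mono
  zero V := by
    have := Realizes.one (d := d) V
    rw [← monomial_one_zero] at this
    exact this
  add h h' := by
    have := Realizes.mul h' h
    rw [monomial_mul] at this
    exact this
  parallel hV h h' := by
    have := Realizes.parallel hV h h'
    rw [monomial_mul] at this
    simp only [Equiv.Perm.coe_one, id, one_mul] at this
    rw [add_comm]
    exact this

/-- The shear by `A` only changes the wires in `T`, by amounts that do not depend on these
wires. -/
def ShearOnto (T : Finset W) (D : ℕ) (V : Finset W) (A : BasisState d W → BasisState d W) : Prop :=
  Shear D V A ∧ (∀ s, ∀ w ∉ T, A s w = 0) ∧ ∀ s s', (∀ w ∉ T, s w = s' w) → A s = A s'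

theorem ShearOnto.schedulable (T : Finset W) : Schedulable W (ShearOnto (d := d) (W := W) T) where
  mono := by
    rintro D D' V V' A ⟨⟨σ, h1, h2⟩, h3⟩ hD hV
    exact ⟨⟨σ, h1, Realizes.mono h2 hD hV⟩, h3⟩
  zero V := ⟨⟨1, by simp, by
    have := Realizes.one (d := d) V
    rw [← monomial_one_zero] at this
    exact this⟩, by simp, by simp⟩
  add := by
    rintro D D' V A A' ⟨⟨σ, h1, h2⟩, h3, h4⟩ ⟨⟨σ', h1', h2'⟩, h3', h4'⟩
    refine ⟨⟨σ' * σ, fun s => ?_, h2'.mul h2⟩, fun s w hw => by simp [h3 s w hw, h3' s w hw],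
      fun s s' h => by simp [h4 s s' h, h4' s s' h]⟩
    rw [Equiv.Perm.mul_apply, h1', h1, h4' (s + A s) s fun w hw => by simp [h3 s w hw]]
    simp [add_assoc]
  parallel := by
    rintro D V V' A A' hV ⟨⟨σ, h1, h2⟩, h3, h4⟩ ⟨⟨σ', h1', h2'⟩, h3', h4'⟩
    refine ⟨⟨σ' * σ, fun s => ?_, ?_⟩, fun s w hw => by simp [h3 s w hw, h3' s w hw],
      fun s s' h => by simp [h4 s s' h, h4' s s' h]⟩
    · rw [Equiv.Perm.mul_apply, h1', h1, h4' (s + A s) s fun w hw => by simp [h3 s w hw]]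
      simp [add_assoc]
    · rw [Finset.union_comm]
      exact h2'.parallel hV.symm h2

end

section

variable {d : ℕ} [NeZero d] {W : Type} [DecidableEq W] [Fintype W]

/-! ### Loading sums of one-wire functions -/

/-- Functions `p` for which a constant number of layers suffices to add `p (s a)` to another
wire. -/
def IsCheap (p : ZMod d → ZMod d) : Prop :=
  p = 0 ∨ p = id ∨ ∃ π π' : Equiv.Perm (ZMod d), ∀ x, p x = π x - π' x

theorem ShearOnto.neg {T : Finset W} {D : ℕ} {V : Finset W}
    {A : BasisState d W → BasisState d W} (h : ShearOnto T D V A) :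
    ShearOnto T (3 * D) V (-A) := by
  obtain ⟨⟨σ, h1, h2⟩, h3, h4⟩ := h
  refine ⟨⟨σ⁻¹, fun s => ?_, Realizes.inv h2⟩, fun s w hw => by simp [h3 s w hw],
    fun s s' h => by simp [h4 s s' h]⟩
  rw [Equiv.Perm.inv_eq_iff_eq, h1, h4 (s + (-A) s) s fun w hw => by simp [h3 s w hw]]
  simp

theorem sumPerm_apply (a b : W) (hab : a ≠ b) (s : BasisState d W) :
    sumPerm a b hab s = s + Pi.single b (s a) := by
  funext v
  by_cases hv : v = b
  · subst hv; simp [sumPerm, add_comm]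
  · simp [sumPerm, hv]

theorem ShearOnto.of_perm {a b : W} (hab : a ≠ b) {T : Finset W} (ha : a ∉ T) (hb : b ∈ T)
    (π : Equiv.Perm (ZMod d)) :
    ShearOnto T 3 {a, b} (fun s : BasisState d W => Pi.single b (π (s a))) := by
  refine ⟨⟨wirePerm a π⁻¹ * (sumPerm a b hab * wirePerm a π), fun s => ?_, ?_⟩,
    fun s w hw => ?_, fun s s' h => ?_⟩
  · rw [Equiv.Perm.mul_apply, Equiv.Perm.mul_apply, sumPerm_apply]
    funext v
    by_cases hva : v = a
    · subst hva; simp [wirePerm, hab]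
    · by_cases hvb : v = b
      · subst hvb; simp [wirePerm, hva]
      · simp [wirePerm, hva, hvb]
  · have h1 : Moves 1 ({a, b} : Finset W) (wirePerm a π) :=
      (Realizes.wire a π fun _ => 0).mono le_rfl (by simp)
    have h2 : Moves 1 ({a, b} : Finset W) (wirePerm a π⁻¹) :=
      (Realizes.wire a π⁻¹ fun _ => 0).mono le_rfl (by simp)
    exact h2.mul (Moves.mul (Realizes.sumPerm a b hab) h1)
  · exact Pi.single_eq_of_ne (by rintro rfl; exact hw hb) _
  · simp only [h a ha]

theorem IsCheap.shearOnto {p : ZMod d → ZMod d} (hp : IsCheap p) {a b : W} (hab : a ≠ b)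
    {T : Finset W} (ha : a ∉ T) (hb : b ∈ T) :
    ShearOnto T 12 {a, b} (fun s : BasisState d W => Pi.single b (p (s a))) := by
  have hS := ShearOnto.schedulable (d := d) T
  rcases hp with rfl | rfl | ⟨π, π', h⟩
  · have := hS.mono (hS.zero {a, b}) (Nat.zero_le 12) le_rfl
    convert this using 1
    ext s
    simp
  · exact hS.mono (ShearOnto.of_perm hab ha hb 1) (by norm_num) le_rfl
  · have := hS.add (ShearOnto.of_perm hab ha hb π) (ShearOnto.of_perm hab ha hb π').neg
    convert this using 1
    funext s
    simp [h, Pi.single_sub, ← sub_eq_add_neg]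

/-- The words `w a` in the source wires `β` are added to the target wires `α a`. -/
theorem ShearOnto.load {A ρ : Type} [Fintype A] [Fintype ρ] (α : A → W) (β : ρ → W)
    (hα : Function.Injective α) (hβ : Function.Injective β) (hαβ : ∀ a l, α a ≠ β l)
    (U : Finset W) (hUα : ∀ a, α a ∈ U) (hUβ : ∀ l, β l ∈ U)
    (w : A → ρ → ZMod d → ZMod d) (hw : ∀ a l, IsCheap (w a l)) :
    ShearOnto (Finset.univ.image α) ((Fintype.card A + Fintype.card ρ) * 12) U
      (fun s : BasisState d W => ∑ a, Pi.single (α a) (∑ l, w a l (s (β l)))) := by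
  have := (ShearOnto.schedulable (d := d) (Finset.univ.image α)).sum_pairs (c := 12) α β hα hβ hαβ
    U hUα hUβ (fun a l s => Pi.single (α a) (w a l (s (β l)))) (fun a l => by
      rw [Finset.pair_comm]
      refine (hw a l).shearOnto (hαβ a l).symm ?_ (by simp)
      simp [hαβ])
  convert this using 1
  funext s v
  simp only [Finset.sum_apply]
  refine Finset.sum_congr rfl fun a _ => ?_
  by_cases hv : v = α a
  · subst hv; simp
  · simp [hv]

theorem Phase.wire (w : W) (g : ZMod d → ℝ) :
    Phase 1 {w} (fun s : BasisState d W => g (s w)) := by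
  have := Realizes.wire w 1 g
  rwa [wirePerm_one] at this

/-- One job: with `B` wires `L a`, `B` wires `R b` and the sources loaded with words, all `B ^ 2`
pairs of wires `L a`, `R b` are combined in depth proportional to `B`. -/
theorem Phase.job {ρ : Type} [Fintype ρ] {B : ℕ} (φ : ρ ⊕ (Fin B ⊕ Fin B) → W)
    (hφ : Function.Injective φ) (U : Finset W) (hU : ∀ i, φ i ∈ U)
    (w w' : Fin B → ρ → ZMod d → ZMod d) (hw : ∀ a l, IsCheap (w a l))
    (hw' : ∀ a l, IsCheap (w' a l)) (g : Fin B → Fin B → ZMod d → ℝ) :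
    Phase (106 * (B + Fintype.card ρ)) U (fun s : BasisState d W => ∑ a, ∑ b,
      g a b ((s (φ (.inr (.inl a))) + ∑ l, w a l (s (φ (.inl l)))) +
        (s (φ (.inr (.inr b))) + ∑ l, w' b l (s (φ (.inl l)))))) := by
  have core : Phase ((B + B) * 5) U (∑ a, ∑ b, fun s : BasisState d W =>
      g a b (s (φ (.inr (.inl a))) + s (φ (.inr (.inr b))))) := by
    have := (Phase.schedulable (d := d) (W := W)).sum_pairs (c := 5)
      (fun a => φ (.inr (.inl a))) (fun b => φ (.inr (.inr b)))
      (fun a a' h => by simpa using hφ h) (fun a a' h => by simpa using hφ h)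
      (fun a b h => by simpa using hφ h) U (fun _ => hU _) (fun _ => hU _)
      (fun a b s => g a b (s (φ (.inr (.inl a))) + s (φ (.inr (.inr b))))) (fun a b => by
        have hne : φ (.inr (.inr b)) ≠ φ (.inr (.inl a)) := fun h => by simpa using hφ h
        have h1 : Moves 1 _ (sumPerm (d := d) _ _ hne) := Realizes.sumPerm _ _ hne
        have h2 := Phase.schedulable.mono (Phase.wire (φ (.inr (.inl a))) (g a b)) le_rfl
          (show {φ (.inr (.inl a))} ⊆ ({φ (.inr (.inr b)), φ (.inr (.inl a))} : Finset W) by simp)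
        have := h2.conj h1
        rw [Finset.pair_comm]
        simpa [sumPerm_apply] using this)
    simpa using this
  obtain ⟨⟨σ, h1, h2⟩, -⟩ := ShearOnto.load (fun a => φ (.inr a)) (fun l => φ (.inl l))
    (fun a a' h => by simpa using hφ h) (fun a a' h => by simpa using hφ h)
    (fun a b h => by simpa using hφ h) U (fun _ => hU _) (fun _ => hU _)
    (Sum.elim w w') (by rintro (a | a) l; exacts [hw a l, hw' a l])
  have := core.conj h2
  refine Phase.schedulable.mono (D := 4 * ((Fintype.card (Fin B ⊕ Fin B) + Fintype.card ρ) * 12) +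
    (B + B) * 5) ?_ (by simp; ring_nf; omega) le_rfl
  convert this using 1
  funext s
  have key : ∀ c, σ s (φ (.inr c)) = s (φ (.inr c)) + ∑ l, Sum.elim w w' c l (s (φ (.inl l))) := by
    intro c
    rw [h1, Pi.add_apply]
    simp only [Finset.sum_apply]
    rw [Finset.sum_eq_single c]
    · simp
    · intro b _ hb
      exact Pi.single_eq_of_ne (fun e => hb (by simpa using (hφ e).symm)) _
    · simp
  simp [Finset.sum_apply, key]

/-- Jobs are distributed over `G` groups of wires. The families of words are cut into blocks of
length `B`; each pair of blocks is one job. -/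
theorem Phase.table {ρ ι ι' : Type} [Fintype ρ] [Fintype ι] [Fintype ι'] {G B Q Q' T : ℕ}
    (φ : Fin G → ρ ⊕ (Fin B ⊕ Fin B) → W)
    (hφ : ∀ i j x y, φ i x = φ j y → i = j ∧ x = y) (U : Finset W) (hU : ∀ i x, φ i x ∈ U)
    (w : ι → ρ → ZMod d → ZMod d) (w' : ι' → ρ → ZMod d → ZMod d) (hw : ∀ a l, IsCheap (w a l))
    (hw' : ∀ a l, IsCheap (w' a l)) (hQ : Fintype.card ι ≤ Q * B) (hQ' : Fintype.card ι' ≤ Q' * B)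
    (hT : Q * Q' ≤ T * G) :
    ∃ (γ : ι → ι' → Fin G) (a : ι → Fin B) (b : ι' → Fin B), ∀ g : ι → ι' → ZMod d → ℝ,
      Phase (T * (106 * (B + Fintype.card ρ))) U (fun s : BasisState d W => ∑ i, ∑ j,
        g i j ((s (φ (γ i j) (.inr (.inl (a i)))) + ∑ l, w i l (s (φ (γ i j) (.inl l)))) +
          (s (φ (γ i j) (.inr (.inr (b j)))) + ∑ l, w' j l (s (φ (γ i j) (.inl l)))))) := by
  classical
  -- A pair of blocks is assigned to a time and a group, a word to a block and a place in it.
  obtain ⟨e⟩ : Nonempty (Fin Q × Fin Q' ↪ Fin T × Fin G) :=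
    Function.Embedding.nonempty_of_card_le (by simpa using hT)
  obtain ⟨e₁⟩ : Nonempty (ι ↪ Fin Q × Fin B) :=
    Function.Embedding.nonempty_of_card_le (by simpa using hQ)
  obtain ⟨e₂⟩ : Nonempty (ι' ↪ Fin Q' × Fin B) :=
    Function.Embedding.nonempty_of_card_le (by simpa using hQ')
  refine ⟨fun i j => (e ((e₁ i).1, (e₂ j).1)).2, fun i => (e₁ i).2, fun j => (e₂ j).2,
    fun g => ?_⟩
  let v : Fin Q × Fin B → ρ → ZMod d → ZMod d := Function.extend e₁ w 0
  let v' : Fin Q' × Fin B → ρ → ZMod d → ZMod d := Function.extend e₂ w' 0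
  let g' : Fin Q × Fin B → Fin Q' × Fin B → ZMod d → ℝ :=
    Function.extend e₁ (fun i => Function.extend e₂ (g i) 0) 0
  have hv : ∀ q l, IsCheap (v q l) := by
    intro q l
    by_cases h : ∃ i, e₁ i = q
    · obtain ⟨i, rfl⟩ := h
      simp only [v, e₁.injective.extend_apply]
      exact hw i l
    · simp only [v, Function.extend_apply' _ _ _ h]
      exact Or.inl rfl
  have hv' : ∀ q l, IsCheap (v' q l) := by
    intro q l
    by_cases h : ∃ i, e₂ i = q
    · obtain ⟨i, rfl⟩ := h
      simp only [v', e₂.injective.extend_apply]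
      exact hw' i l
    · simp only [v', Function.extend_apply' _ _ _ h]
      exact Or.inl rfl
  let F : Fin Q × Fin B → Fin Q' × Fin B → BasisState d W → ℝ := fun p p' s =>
    g' p p' ((s (φ (e (p.1, p'.1)).2 (.inr (.inl p.2))) +
      ∑ l, v p l (s (φ (e (p.1, p'.1)).2 (.inl l)))) +
      (s (φ (e (p.1, p'.1)).2 (.inr (.inr p'.2))) +
      ∑ l, v' p' l (s (φ (e (p.1, p'.1)).2 (.inl l)))))
  have main := (Phase.schedulable (d := d) (W := W)).sum (J := Fin Q × Fin Q') (T := T)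
    (c := 106 * (B + Fintype.card ρ)) (fun q => (e q).1)
    (fun q => Finset.univ.image (φ (e q).2)) U
    (fun q => by
      intro x hx
      obtain ⟨y, -, rfl⟩ := Finset.mem_image.1 hx
      exact hU _ _)
    (fun q q' hne ht => by
      rw [Finset.disjoint_left]
      intro x hx hx'
      obtain ⟨y, -, rfl⟩ := Finset.mem_image.1 hx
      obtain ⟨y', -, h⟩ := Finset.mem_image.1 hx'
      exact hne (e.injective (Prod.ext ht (hφ _ _ _ _ h).1.symm)))
    (fun q s => ∑ a, ∑ b, F (q.1, a) (q.2, b) s)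
    (fun q => Phase.job (φ (e q).2) (fun x y h => (hφ _ _ _ _ h).2) _
      (fun i => Finset.mem_image_of_mem _ (Finset.mem_univ i)) (fun a => v (q.1, a))
      (fun b => v' (q.2, b)) (fun a l => hv _ l) (fun b l => hv' _ l)
      (fun a b => g' (q.1, a) (q.2, b)))
  convert main using 1
  funext s
  have e2sum : ∀ p, ∑ p', F p p' s = ∑ j, F p (e₂ j) s := by
    intro p
    symm
    refine Finset.sum_of_injOn e₂ e₂.injective.injOn (by simp) (fun p' _ hp' => ?_)
      (fun _ _ => rfl)
    have h : ¬ ∃ j, e₂ j = p' := fun ⟨j, hj⟩ => hp' ⟨j, by simp, hj⟩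
    have : g' p p' = 0 := by
      by_cases hp : ∃ i, e₁ i = p
      · obtain ⟨i, rfl⟩ := hp
        simp only [g', e₁.injective.extend_apply, Function.extend_apply' _ _ _ h, Pi.zero_apply]
      · simp only [g', Function.extend_apply' _ _ _ hp, Pi.zero_apply]
    simp [F, this]
  have e1sum : ∑ p, ∑ p', F p p' s = ∑ i, ∑ j, F (e₁ i) (e₂ j) s := by
    symm
    simp only [e2sum]
    refine Finset.sum_of_injOn e₁ e₁.injective.injOn (by simp) (fun p _ hp => ?_)
      (fun _ _ => rfl)
    have h : ¬ ∃ j, e₁ j = p := fun ⟨j, hj⟩ => hp ⟨j, by simp, hj⟩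
    have : g' p = 0 := by simp only [g', Function.extend_apply' _ _ _ h, Pi.zero_apply]
    simp [F, this]
  have lhs : ∀ i j, F (e₁ i) (e₂ j) s = g i j
      ((s (φ (e ((e₁ i).1, (e₂ j).1)).2 (.inr (.inl (e₁ i).2))) +
        ∑ l, w i l (s (φ (e ((e₁ i).1, (e₂ j).1)).2 (.inl l)))) +
      (s (φ (e ((e₁ i).1, (e₂ j).1)).2 (.inr (.inr (e₂ j).2))) +
        ∑ l, w' j l (s (φ (e ((e₁ i).1, (e₂ j).1)).2 (.inl l))))) := by
    intro i j
    simp only [F, g', v, v', e₁.injective.extend_apply, e₂.injective.extend_apply]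
  simp only [← lhs]
  rw [← e1sum, Fintype.sum_prod_type, Finset.sum_apply, Fintype.sum_prod_type]
  refine Finset.sum_congr rfl fun q _ => ?_
  rw [Finset.sum_comm]
  simp only [Fintype.sum_prod_type]
  refine Finset.sum_congr rfl fun q' _ => ?_
  rw [Finset.sum_comm]

end

section

variable {d : ℕ} [NeZero d]

/-! ### Complete families of phase arguments -/

open ZMod (stdAddChar)

open Classical in
/-- A family of functions `L i : X → ℤ/d` is complete if, for every nontrivial character of
`ℤ/d`, its compositions with the `L i` span the functions on `X`. -/
def Complete {ι X : Type} (L : ι → X → ZMod d) : Prop :=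
  ∀ j : ZMod d, j ≠ 0 → ∀ x₀ : X, (fun x => if x = x₀ then (1 : ℂ) else 0) ∈
    Submodule.span ℂ (Set.range fun i x => stdAddChar (j * L i x))

open Classical in
theorem Complete.exists_coeff {ι X : Type} [Fintype ι] {L : ι → X → ZMod d} (hL : Complete L)
    {j : ZMod d} (hj : j ≠ 0) (x₀ : X) :
    ∃ c : ι → ℂ, ∀ x, ∑ i, c i * stdAddChar (j * L i x) = if x = x₀ then 1 else 0 := by
  obtain ⟨c, hc⟩ := (Submodule.mem_span_range_iff_exists_fun ℂ).1 (hL j hj x₀)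
  exact ⟨c, fun x => by simpa using congrFun hc x⟩

open Classical in
theorem Complete.of_coeff {ι X : Type} [Fintype ι] {L : ι → X → ZMod d}
    (h : ∀ j : ZMod d, j ≠ 0 → ∀ x₀ : X, ∃ c : ι → ℂ, ∀ x,
      ∑ i, c i * stdAddChar (j * L i x) = if x = x₀ then 1 else 0) : Complete L := by
  intro j hj x₀
  obtain ⟨c, hc⟩ := h j hj x₀
  exact (Submodule.mem_span_range_iff_exists_fun ℂ).2 ⟨c, funext fun x => by simpa using hc x⟩

theorem Complete.prod {ι κ X Y : Type} [Fintype ι] [Fintype κ] {L : ι → X → ZMod d}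
    {L' : κ → Y → ZMod d} (hL : Complete L) (hL' : Complete L') :
    Complete fun (i : ι × κ) (z : X × Y) => L i.1 z.1 + L' i.2 z.2 := by
  refine Complete.of_coeff fun j hj x₀ => ?_
  obtain ⟨c, hc⟩ := hL.exists_coeff hj x₀.1
  obtain ⟨c', hc'⟩ := hL'.exists_coeff hj x₀.2
  refine ⟨fun i => c i.1 * c' i.2, fun x => ?_⟩
  have h1 : ∑ i : ι × κ, c i.1 * c' i.2 * stdAddChar (j * (L i.1 x.1 + L' i.2 x.2)) =
      (∑ i, c i * stdAddChar (j * L i x.1)) * ∑ i, c' i * stdAddChar (j * L' i x.2) := by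
    rw [Finset.sum_mul_sum, Fintype.sum_prod_type]
    refine Finset.sum_congr rfl fun i _ => Finset.sum_congr rfl fun k _ => ?_
    rw [mul_add, AddChar.map_add_eq_mul]
    ring
  rw [h1, hc, hc']
  by_cases h : x.1 = x₀.1 <;> by_cases h' : x.2 = x₀.2 <;> simp [h, h', Prod.ext_iff]

theorem stdAddChar_sum {ρ : Type} (I : Finset ρ) (a : ρ → ZMod d) :
    (stdAddChar (∑ l ∈ I, a l) : ℂ) = ∏ l ∈ I, stdAddChar (a l) := by
  classical
  induction I using Finset.induction_on with
  | empty => simp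
  | insert i I hi ih => rw [Finset.sum_insert hi, Finset.prod_insert hi, AddChar.map_add_eq_mul, ih]

theorem Complete.pi {ι X ρ : Type} [Fintype ι] [Fintype ρ] {p : ι → X → ZMod d}
    (hp : Complete p) :
    Complete fun (k : ρ → ι) (x : ρ → X) => ∑ l, p (k l) (x l) := by
  classical
  refine Complete.of_coeff fun j hj x₀ => ?_
  choose c hc using fun l => hp.exists_coeff hj (x₀ l)
  refine ⟨fun k => ∏ l, c l (k l), fun x => ?_⟩
  have h1 : ∑ k : ρ → ι, (∏ l, c l (k l)) * stdAddChar (j * ∑ l, p (k l) (x l)) =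
      ∏ l, ∑ i, c l i * stdAddChar (j * p i (x l)) := by
    rw [Finset.prod_univ_sum, Fintype.piFinset_univ]
    refine Finset.sum_congr rfl fun k _ => ?_
    rw [Finset.prod_mul_distrib, Finset.mul_sum, stdAddChar_sum]
  rw [h1]
  simp only [hc]
  by_cases h : x = x₀
  · simp [h]
  · obtain ⟨l, hl⟩ := Function.ne_iff.1 h
    rw [if_neg h, Finset.prod_eq_zero (Finset.mem_univ l) (if_neg hl)]

theorem stdAddChar_ne_one {j : ZMod d} (hj : j ≠ 0) : stdAddChar j ≠ (1 : ℂ) := by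
  intro h
  refine hj (ZMod.injective_stdAddChar ?_)
  simpa using h

/-- Functions of a leading argument `y` and of `x` are, up to a function of `x` alone, sums of
functions of the single arguments `y + L i x`, for a complete family `L`. These functions can be
taken to be differences. -/
theorem Complete.leading {ι X : Type} [Fintype ι] [Fintype X] {L : ι → X → ZMod d}
    (hL : Complete L) (f : ZMod d → X → ℝ) :
    ∃ (f₀ : X → ℝ) (h : ι → ZMod d → ℝ), ∀ y x,
      f y x = f₀ x + ∑ i, (h i (y + L i x) - h i (y + L i x + 1)) := by
  classical
  choose c hc using fun (j : ZMod d) (hj : j ≠ 0) (x₀ : X) => hL.exists_coeff hj x₀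
  let F : ZMod d → X → ℂ := fun j x => (d : ℂ)⁻¹ * ∑ y, f y x * stdAddChar (-(j * y))
  let C : ZMod d → ι → ℂ := fun j i =>
    if hj : j = 0 then 0 else ∑ x₀, F j x₀ * c j hj x₀ i
  have hd : (d : ℂ) ≠ 0 := Nat.cast_ne_zero.2 (NeZero.ne d)
  have hF : ∀ y x, (f y x : ℂ) = ∑ j, F j x * stdAddChar (j * y) := by
    intro y x
    simp only [F, Finset.mul_sum, Finset.sum_mul]
    rw [Finset.sum_comm, Finset.sum_eq_single y]
    · have : ∀ j : ZMod d, (d : ℂ)⁻¹ * (f y x * stdAddChar (-(j * y))) * stdAddChar (j * y) =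
          (d : ℂ)⁻¹ * f y x := by
        intro j
        rw [mul_assoc, mul_assoc, ← AddChar.map_add_eq_mul]
        simp
      simp only [this, Finset.sum_const, Finset.card_univ, ZMod.card, nsmul_eq_mul]
      rw [← mul_assoc, mul_inv_cancel₀ hd, one_mul]
    · intro z _ hz
      have : ∀ j : ZMod d, (d : ℂ)⁻¹ * (f z x * stdAddChar (-(j * z))) * stdAddChar (j * y) =
          (d : ℂ)⁻¹ * f z x * stdAddChar (j * (y - z)) := by
        intro j
        rw [mul_assoc, mul_assoc, ← AddChar.map_add_eq_mul, mul_assoc]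
        congr 4
        ring
      simp only [this, ← Finset.mul_sum]
      rw [AddChar.sum_mulShift _ (ZMod.isPrimitive_stdAddChar d), if_neg (sub_ne_zero.2 hz.symm)]
      simp
    · simp
  have hC : ∀ j, j ≠ 0 → ∀ x, F j x = ∑ i, C j i * stdAddChar (j * L i x) := by
    intro j hj x
    simp only [C, hj, dif_neg, not_false_eq_true, Finset.sum_mul]
    rw [Finset.sum_comm]
    have : ∀ x₀, ∑ i, F j x₀ * c j hj x₀ i * stdAddChar (j * L i x) =
        F j x₀ * if x = x₀ then 1 else 0 := by
      intro x₀
      rw [← hc j hj x₀, Finset.mul_sum]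
      exact Finset.sum_congr rfl fun i _ => mul_assoc _ _ _
    simp [this]
  -- Since only nontrivial characters occur, their sum is a difference of shifts.
  let H : ι → ZMod d → ℂ := fun i z =>
    ∑ j ∈ Finset.univ.erase 0, C j i / (1 - stdAddChar j) * stdAddChar (j * z)
  have hH : ∀ i z, H i z - H i (z + 1) =
      ∑ j ∈ Finset.univ.erase 0, C j i * stdAddChar (j * z) := by
    intro i z
    simp only [H]
    rw [← Finset.sum_sub_distrib]
    refine Finset.sum_congr rfl fun j hj => ?_
    have : (1 : ℂ) - stdAddChar j ≠ 0 :=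
      sub_ne_zero.2 (stdAddChar_ne_one (Finset.ne_of_mem_erase hj)).symm
    rw [mul_add, mul_one, AddChar.map_add_eq_mul]
    field_simp
  refine ⟨fun x => (F 0 x).re, fun i z => (H i z).re, fun y x => ?_⟩
  have : (f y x : ℂ) = F 0 x + ∑ i, (H i (y + L i x) - H i (y + L i x + 1)) := by
    rw [hF, ← Finset.add_sum_erase _ _ (Finset.mem_univ (0 : ZMod d))]
    simp only [hH, zero_mul, AddChar.map_zero_eq_one, mul_one]
    rw [Finset.sum_comm]
    congr 1
    refine Finset.sum_congr rfl fun j hj => ?_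
    rw [hC j (Finset.ne_of_mem_erase hj), Finset.sum_mul]
    refine Finset.sum_congr rfl fun i _ => ?_
    rw [mul_assoc, ← AddChar.map_add_eq_mul]
    congr 2
    ring
  have := congrArg Complex.re this
  simpa [Complex.re_sum] using this

/-- For `d ≥ 3` the functions are `0` and the differences of the indicators of `{k}` and `{0}`, for
`k ≠ 0`; such a difference is a difference of two permutations. For `d = 2` they are `0` and the
identity. -/
theorem exists_complete_cheap (hd : 2 ≤ d) :
    ∃ p : ZMod d → ZMod d → ZMod d, (∀ k, IsCheap (p k)) ∧ Complete p := by
  classical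
  obtain rfl | hd : d = 2 ∨ 3 ≤ d := by omega
  · refine ⟨fun k x => k * x, fun k => ?_, fun j hj x₀ => ?_⟩
    · fin_cases k
      · exact Or.inl (funext fun x => zero_mul x)
      · exact Or.inr (Or.inl (funext fun x => one_mul x))
    · have hj1 : j = 1 := by revert j; decide
      subst hj1
      have hz : (1 : ℂ) - stdAddChar (1 : ZMod 2) ≠ 0 :=
        sub_ne_zero.2 (stdAddChar_ne_one hj).symm
      rw [Submodule.mem_span_range_iff_exists_fun]
      have key : ∀ x : ZMod 2, x = 0 ∨ x = 1 := by decide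
      have hu : (Finset.univ : Finset (ZMod 2)) = {0, 1} := rfl
      rcases key x₀ with rfl | rfl
      · refine ⟨fun k => if k = 0 then -stdAddChar (1 : ZMod 2) / (1 - stdAddChar (1 : ZMod 2))
          else 1 / (1 - stdAddChar (1 : ZMod 2)), funext fun x => ?_⟩
        rcases key x with rfl | rfl <;> simp [hu] <;> field_simp <;> ring
      · refine ⟨fun k => if k = 0 then 1 / (1 - stdAddChar (1 : ZMod 2))
          else -1 / (1 - stdAddChar (1 : ZMod 2)), funext fun x => ?_⟩
        rcases key x with rfl | rfl <;> simp [hu] <;> field_simp <;> ring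
  · have : Fact (1 < d) := ⟨by omega⟩
    let p : ZMod d → ZMod d → ZMod d := fun k x =>
      if k = 0 then 0 else (if x = k then 1 else 0) - (if x = 0 then 1 else 0)
    refine ⟨p, fun k => ?_, fun j hj => ?_⟩
    · by_cases hk : k = 0
      · exact Or.inl (by ext x; simp [p, hk])
      · -- `π'` maps `k` to `0` and `0` to `1`.
        let π' : Equiv.Perm (ZMod d) := Equiv.swap k 1 * Equiv.swap 0 k
        have h0 : π' 0 = 1 := by simp [π']
        have hk' : π' k = 0 := by
          simp only [π', Equiv.Perm.mul_apply, Equiv.swap_apply_right]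
          exact Equiv.swap_apply_of_ne_of_ne (Ne.symm hk) zero_ne_one
        refine Or.inr (Or.inr ⟨Equiv.swap 0 1 * π', π', fun x => ?_⟩)
        simp only [p, if_neg hk, Equiv.Perm.mul_apply]
        by_cases hx : x = k
        · subst hx; simp [hk', hk]
        · by_cases hx0 : x = 0
          · subst hx0; simp [h0, hx]
          · rw [Equiv.swap_apply_of_ne_of_ne]
            · simp [hx, hx0]
            · rw [← hk']; exact π'.injective.ne hx
            · rw [← h0]; exact π'.injective.ne hx0
    · set ζ : ℂ := stdAddChar j with hζ
      have hζ1 : ζ ≠ 1 := stdAddChar_ne_one hj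
      have hnorm : ‖ζ‖ = 1 := by rw [hζ]; exact AddChar.norm_apply _ _
      have hζ0 : ζ ≠ 0 := fun h => by simp [h] at hnorm
      set S := Submodule.span ℂ (Set.range fun i x => stdAddChar (j * p i x)) with hS
      have hp : ∀ k x, stdAddChar (j * p k x) = if k = 0 then (1 : ℂ) else
          if x = k then ζ else if x = 0 then ζ⁻¹ else 1 := by
        intro k x
        by_cases hk : k = 0
        · simp [p, hk]
        · by_cases hx : x = k
          · subst hx; simp [p, hk, hζ]
          · by_cases hx0 : x = 0
            · subst hx0; simp [p, hk, Ne.symm hk, hζ, AddChar.map_neg_eq_inv]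
            · simp [p, hk, hx, hx0]
      have hv : ∀ k, (fun x => stdAddChar (j * p k x)) ∈ S := fun k =>
        Submodule.subset_span ⟨k, rfl⟩
      have hone : (fun _ => (1 : ℂ)) ∈ S := by
        have := hv 0
        simpa [hp] using this
      have hD : (1 - ζ) * (1 + ((d : ℂ) - 1) * ζ⁻¹) ≠ 0 := by
        refine mul_ne_zero (sub_ne_zero.2 hζ1.symm) fun h => ?_
        have h1 : ((d : ℂ) - 1) = -ζ := by
          field_simp at h
          linear_combination h
        have h2 := congrArg norm h1
        rw [norm_neg, hnorm, show ((d : ℂ) - 1) = ((d - 1 : ℕ) : ℂ) by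
          rw [Nat.cast_sub (by omega)]; simp, Complex.norm_natCast] at h2
        have : d - 1 = 1 := by exact_mod_cast h2
        omega
      have hzero : (fun x : ZMod d => if x = 0 then (1 : ℂ) else 0) ∈ S := by
        have h1 : (∑ k ∈ Finset.univ.erase (0 : ZMod d), fun x => stdAddChar (j * p k x)) -
            ((d : ℂ) - 2 + ζ) • (fun _ => (1 : ℂ)) ∈ S :=
          S.sub_mem (S.sum_mem fun k _ => hv k) (S.smul_mem _ hone)
        have h2 := S.smul_mem ((1 - ζ) * (1 + ((d : ℂ) - 1) * ζ⁻¹))⁻¹ h1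
        convert h2 using 1
        funext x
        simp only [Pi.smul_apply, Pi.sub_apply, Finset.sum_apply, smul_eq_mul, mul_one]
        have hcard : ((Finset.univ.erase (0 : ZMod d)).card : ℂ) = d - 1 := by
          rw [Finset.card_erase_of_mem (Finset.mem_univ _), Finset.card_univ, ZMod.card,
            Nat.cast_sub (by omega)]
          simp
        by_cases hx : x = 0
        · subst hx
          have : ∀ k ∈ Finset.univ.erase (0 : ZMod d), stdAddChar (j * p k 0) = ζ⁻¹ := by
            intro k hk
            have hk := Finset.ne_of_mem_erase hk
            simp [hp, hk, Ne.symm hk]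
          rw [Finset.sum_congr rfl this, Finset.sum_const, nsmul_eq_mul, hcard, if_pos rfl]
          rw [eq_comm, inv_mul_eq_one₀ hD]
          field_simp
          ring
        · have h3 : ∀ k ∈ Finset.univ.erase (0 : ZMod d), stdAddChar (j * p k x) =
              1 + if k = x then ζ - 1 else 0 := by
            intro k hk
            have hk := Finset.ne_of_mem_erase hk
            by_cases hxk : x = k
            · subst hxk; simp [hp, hx]
            · simp [hp, hk, hx, hxk, Ne.symm hxk]
          rw [Finset.sum_congr rfl h3, Finset.sum_add_distrib, Finset.sum_const, nsmul_eq_mul,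
            hcard, Finset.sum_ite_eq', if_pos (Finset.mem_erase.2 ⟨hx, Finset.mem_univ x⟩)]
          simp only [hx, if_false]
          ring
      intro x₀
      by_cases hx₀ : x₀ = 0
      · subst hx₀; convert hzero
      · have h1 := S.smul_mem (ζ - 1)⁻¹ (S.sub_mem (S.sub_mem (hv x₀) hone)
          (S.smul_mem (ζ⁻¹ - 1) hzero))
        convert h1 using 1
        funext x
        have hz : ζ - 1 ≠ 0 := sub_ne_zero.2 hζ1
        simp only [Pi.smul_apply, Pi.sub_apply, smul_eq_mul, hp, if_neg hx₀]
        by_cases hx : x = x₀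
        · subst hx; simp [hx₀, hz]
        · by_cases hx0 : x = 0
          · subst hx0; simp [hx]
          · simp [hx, hx0]

/-- A family of words `w` in the wires `ρ` is generating if, together with any complete family `L`
in further arguments, it yields all functions up to functions of the further arguments alone. -/
def Generating {ι ρ : Type} [Fintype ι] [Fintype ρ] (w : ι → ρ → ZMod d → ZMod d) : Prop :=
  ∀ (κ Y : Type) [Fintype κ] [Fintype Y] (L : κ → Y → ZMod d), Complete L →
    ∀ f : Y → (ρ → ZMod d) → ℝ, ∃ (f₀ : Y → ℝ) (g : κ → ι → ZMod d → ℝ), ∀ y x,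
      f y x = f₀ y + ∑ k, ∑ i, g k i (L k y + ∑ l, w i l (x l))

/-- The words of the generating family have one leading letter, the identity; all letters before
the leading one are zero, all later letters are arbitrary members of a complete family. -/
theorem exists_generating (hd : 2 ≤ d) (n : ℕ) :
    ∃ (ι : Type) (_ : Fintype ι) (w : ι → Fin n → ZMod d → ZMod d), (∀ i l, IsCheap (w i l)) ∧
      Generating w ∧ Fintype.card ι + 1 ≤ 2 * d ^ n ∧ Fintype.card ι * d ≤ 2 * d ^ n ∧
      (1 ≤ n → d ^ (n - 1) ≤ Fintype.card ι) := by
  obtain ⟨p, hp, hpc⟩ := exists_complete_cheap hd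
  induction n with
  | zero =>
    refine ⟨Empty, inferInstance, fun i => i.elim, fun i => i.elim, ?_, by simp, by simp, by simp⟩
    intro κ Y _ _ L hL f
    refine ⟨fun y => f y Fin.elim0, fun _ i => i.elim, fun y x => ?_⟩
    simp [Subsingleton.elim x Fin.elim0]
  | succ n ih =>
    obtain ⟨ι, _, w, hw, hgen, hcard1, hcard2, hcard3⟩ := ih
    refine ⟨(Fin n → ZMod d) ⊕ ι, inferInstance,
      Sum.elim (fun k => Fin.cons id fun l => p (k l)) (fun i => Fin.cons 0 (w i)),
      ?_, ?_, ?_, ?_, ?_⟩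
    · rintro (k | i) l
      · refine Fin.cases ?_ (fun l => ?_) l
        · exact Or.inr (Or.inl rfl)
        · exact hp _
      · refine Fin.cases ?_ (fun l => ?_) l
        · exact Or.inl rfl
        · exact hw i l
    · intro κ Y _ _ L hL f
      -- The first letter leads all words in the other letters; the rest does not depend on it.
      have hprod := hL.prod (hpc.pi (ρ := Fin n))
      obtain ⟨f₁, h, hf₁⟩ := hprod.leading fun x₀ z => f z.1 (Fin.cons x₀ z.2)
      obtain ⟨f₀, g, hf₀⟩ := hgen κ Y L hL fun y t => f₁ (y, t)
      refine ⟨f₀, fun k => Sum.elim (fun i z => h (k, i) z - h (k, i) (z + 1)) (g k),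
        fun y x => ?_⟩
      have h1 := hf₁ (x 0) (y, Fin.tail x)
      simp only [Fin.cons_self_tail] at h1
      rw [h1, hf₀, add_assoc, Fintype.sum_prod_type]
      simp only [Fintype.sum_sum_type, Sum.elim_inl, Sum.elim_inr, Finset.sum_add_distrib,
        Fin.sum_univ_succ, Fin.cons_zero, Fin.cons_succ, id]
      congr 1
      rw [add_comm]
      congr 1
      · refine Finset.sum_congr rfl fun k _ => Finset.sum_congr rfl fun i _ => ?_
        have e : x 0 + (L k y + ∑ l, p (i l) (Fin.tail x l)) =
            L k y + (x 0 + ∑ l, p (i l) (x l.succ)) := by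
          simp only [Fin.tail]; ring
        rw [e]
      · simp [Fin.tail]
    · simp only [Fintype.card_sum, Fintype.card_fun, ZMod.card, Fintype.card_fin]
      have : d ^ (n + 1) = d ^ n * d := pow_succ _ _
      nlinarith [Nat.pos_of_ne_zero (pow_ne_zero n (NeZero.ne d))]
    · simp only [Fintype.card_sum, Fintype.card_fun, ZMod.card, Fintype.card_fin]
      have : d ^ (n + 1) = d ^ n * d := pow_succ _ _
      nlinarith [Nat.pos_of_ne_zero (pow_ne_zero n (NeZero.ne d))]
    · intro _
      simp [Fintype.card_sum, ZMod.card, Fintype.card_fin]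

end

section

variable {d : ℕ} [NeZero d] {W : Type} [DecidableEq W] [Fintype W]

open ZMod (stdAddChar)

/-! ### Circuits without parallelism -/

/-- A phase of a single word, whose letters are loaded onto its leading wire. -/
theorem Phase.word {ρ : Type} [Fintype ρ] (y : W) (β : ρ → W) (hβ : Function.Injective β)
    (hy : ∀ l, y ≠ β l) (U : Finset W) (hUy : y ∈ U) (hU : ∀ l, β l ∈ U)
    (w : ρ → ZMod d → ZMod d) (hw : ∀ l, IsCheap (w l)) (g : ZMod d → ℝ) :
    Phase (49 * (Fintype.card ρ + 1)) U
      (fun s : BasisState d W => g (s y + ∑ l, w l (s (β l)))) := by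
  obtain ⟨⟨σ, h1, h2⟩, -⟩ := ShearOnto.load (fun _ : Unit => y) β
    (Function.injective_of_subsingleton _) hβ (fun _ => hy) U (fun _ => hUy) hU (fun _ => w)
    (fun _ => hw)
  have h3 := Phase.schedulable.mono (Phase.wire y g) le_rfl (Finset.singleton_subset_iff.2 hUy)
  have := h3.conj h2
  simp only [h1, Pi.add_apply, Finset.univ_unique, Finset.sum_singleton, Pi.single_eq_same] at this
  exact Phase.schedulable.mono this (by simp; omega) le_rfl

/-- A function of the wires in `V` is, up to a function of the wires other than `y`, a sum of
functions of single words with the leading wire `y`. -/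
theorem exists_peel {p : ZMod d → ZMod d → ZMod d} (hp : Complete p) {V : Finset W} {y : W}
    (hy : y ∈ V) (f : BasisState d W → ℝ) (hf : DependsOn f (V : Set W)) :
    ∃ (f₀ : BasisState d W → ℝ) (h : (V.erase y → ZMod d) → ZMod d → ℝ),
      DependsOn f₀ ((V.erase y : Finset W) : Set W) ∧ ∀ s, f s = f₀ s +
        ∑ k, (h k (s y + ∑ l, p (k l) (s l)) - h k (s y + ∑ l, p (k l) (s l) + 1)) := by
  classical
  obtain ⟨f₀, h, H⟩ := (hp.pi (ρ := V.erase y)).leading fun c x =>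
    f fun v => if hv : v ∈ V.erase y then x ⟨v, hv⟩ else c
  refine ⟨fun s => f₀ fun l => s l, h, fun s s' hs => ?_, fun s => ?_⟩
  · exact congrArg f₀ (funext fun l => hs l l.2)
  · rw [← H (s y) fun l => s l]
    refine hf fun v hv => ?_
    by_cases hvy : v = y
    · subst hvy; simp
    · rw [dif_pos (Finset.mem_erase.2 ⟨hvy, hv⟩)]

/-- Every function of `n + 1` wires is realized as a phase by applying its words one by one. The
factor `n + 1` in the depth is harmless for functions of few wires. -/
theorem Phase.of_dependsOn (hd : 2 ≤ d) (n : ℕ) : ∀ (V : Finset W), V.card = n + 1 →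
    ∀ f : BasisState d W → ℝ, DependsOn f (V : Set W) → Phase (100 * (n + 1) * d ^ n) V f := by
  obtain ⟨p, hpc, hp⟩ := exists_complete_cheap hd
  induction n with
  | zero =>
    intro V hV f hf
    obtain ⟨y, rfl⟩ := Finset.card_eq_one.1 hV
    have := Phase.wire y fun c => f fun _ => c
    convert Phase.schedulable.mono this (show 1 ≤ 100 * (0 + 1) * d ^ 0 by norm_num) le_rfl using 1
    funext s
    exact hf fun v hv => by simp at hv; rw [hv]
  | succ n ih =>
    intro V hV f hf
    obtain ⟨y, hy⟩ : V.Nonempty := Finset.card_pos.1 (by omega)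
    obtain ⟨f₀, h, hf₀, H⟩ := exists_peel hp hy f hf
    have hcard : (V.erase y).card = n + 1 := by rw [Finset.card_erase_of_mem hy]; omega
    have h1 := ih _ hcard f₀ hf₀
    have h2 := (Phase.schedulable (d := d) (W := W)).sum
      (T := Fintype.card (V.erase y → ZMod d)) (Fintype.equivFin (V.erase y → ZMod d)) (fun _ => V) V
      (fun _ => le_rfl) (fun i j hij e => absurd ((Fintype.equivFin _).injective e) hij) _
      (fun k => Phase.word y (fun l : V.erase y => (l : W)) Subtype.val_injective
        (fun l e => (Finset.mem_erase.1 l.2).1 e.symm) V hy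
        (fun l => Finset.mem_of_mem_erase l.2) (fun l => p (k l)) (fun l => hpc _)
        (fun z => h k z - h k (z + 1)))
    have h3 := Phase.schedulable.add
      (Phase.schedulable.mono h1 le_rfl (Finset.erase_subset y V)) h2
    have h4 : f = f₀ + ∑ k, fun s => (h k (s y + ∑ l, p (k l) (s l)) -
        h k (s y + ∑ l, p (k l) (s l) + 1)) := by
      funext s
      simp [H s, Finset.sum_apply]
    rw [h4]
    refine Phase.schedulable.mono h3 ?_ le_rfl
    rw [Fintype.card_fun, ZMod.card, Fintype.card_coe, hcard]
    have : d ^ (n + 1) = d ^ n * d := pow_succ _ _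
    have h5 : 2 * (100 * (n + 1) * d ^ n) ≤ 100 * (n + 1) * d ^ (n + 1) := by
      rw [this]; nlinarith [Nat.zero_le (100 * (n + 1) * d ^ n)]
    nlinarith [Nat.pos_of_ne_zero (pow_ne_zero (n + 1) (NeZero.ne d))]

/-! ### Addition of an arbitrary function to a wire -/

/-- The addition of the value of `Q`, which does not depend on the wire `y`, to this wire. -/
def addPerm (y : W) (Q : BasisState d W → ZMod d) (hQ : ∀ s c, Q (Function.update s y c) = Q s) :
    Equiv.Perm (BasisState d W) where
  toFun s := Function.update s y (s y + Q s)
  invFun s := Function.update s y (s y - Q s)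
  left_inv s := by simp [hQ]
  right_inv s := by simp [hQ]

/-- The unitary matrix of the Fourier transform on `ℤ/d`. -/
def fourierUnitary (d : ℕ) [NeZero d] : Matrix.unitaryGroup (ZMod d) ℂ :=
  ⟨Matrix.of fun k x => ((Real.sqrt d : ℝ) : ℂ)⁻¹ * stdAddChar (k * x), by
    have hd : (d : ℂ) ≠ 0 := Nat.cast_ne_zero.2 (NeZero.ne d)
    have hs : ((Real.sqrt d : ℝ) : ℂ)⁻¹ * ((Real.sqrt d : ℝ) : ℂ)⁻¹ = (d : ℂ)⁻¹ := by
      rw [← mul_inv, ← Complex.ofReal_mul, Real.mul_self_sqrt (Nat.cast_nonneg d)]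
      simp
    rw [Matrix.mem_unitaryGroup_iff']
    refine Matrix.ext fun y x => ?_
    rw [Matrix.mul_apply, Matrix.star_eq_conjTranspose]
    have : ∀ k : ZMod d, (Matrix.of fun k x : ZMod d => ((Real.sqrt d : ℝ) : ℂ)⁻¹ *
        stdAddChar (k * x)).conjTranspose y k * (Matrix.of fun k x : ZMod d =>
          ((Real.sqrt d : ℝ) : ℂ)⁻¹ * stdAddChar (k * x)) k x =
        (d : ℂ)⁻¹ * stdAddChar (k * (x - y)) := by
      intro k
      rw [Matrix.conjTranspose_apply, Matrix.of_apply, Matrix.of_apply, star_mul', RCLike.star_def,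
        ← AddChar.map_neg_eq_conj, map_inv₀, Complex.conj_ofReal, ← hs,
        show k * (x - y) = -(k * y) + k * x by ring, AddChar.map_add_eq_mul]
      ring
    simp only [this, ← Finset.mul_sum]
    rw [AddChar.sum_mulShift _ (ZMod.isPrimitive_stdAddChar d), Matrix.one_apply]
    by_cases h : y = x
    · subst h; simp [hd]
    · rw [if_neg h, if_neg (sub_ne_zero.2 (Ne.symm h))]; simp⟩

theorem exp_val_eq_stdAddChar (c : ZMod d) :
    Complex.exp (((2 * Real.pi * c.val / d : ℝ) : ℂ) * Complex.I) = stdAddChar c := by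
  have := ZMod.stdAddChar_coe (N := d) (c.val : ℤ)
  rw [Int.cast_natCast, ZMod.natCast_zmod_val] at this
  rw [this]
  congr 1
  push_cast
  ring

/-- The addition of `Q` to a wire is the Fourier conjugate, on this wire, of the diagonal unitary
with phases `ω ^ (s y * Q s)`. -/
theorem Moves.addPerm (hd : 2 ≤ d) {n : ℕ} {V : Finset W} (hV : V.card = n + 1) {y : W}
    (hy : y ∈ V) (Q : BasisState d W → ZMod d) (hQ : DependsOn Q ((V.erase y : Finset W) : Set W)) :
    ∃ h, Moves (100 * (n + 1) * d ^ n + 2) V (addPerm y Q h) := by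
  have hQ' : ∀ s c, Q (Function.update s y c) = Q s := fun s c => hQ fun v hv => by
    rw [Function.update_of_ne (Finset.ne_of_mem_erase hv)]
  refine ⟨hQ', ?_⟩
  have hf := Phase.of_dependsOn hd n V hV
    (fun s : BasisState d W => 2 * Real.pi * (s y * Q s).val / d) (fun s s' hs => by
      simp only [hs y hy, hQ fun v hv => hs v (Finset.mem_of_mem_erase hv)])
  have h1 : Realizes 1 V (Gate.single y (fourierUnitary d)).toMatrix :=
    (Realizes.gate _).mono le_rfl (Finset.singleton_subset_iff.2 hy)
  have h2 : Realizes 1 V (Gate.single y (fourierUnitary d)⁻¹).toMatrix :=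
    (Realizes.gate _).mono le_rfl (Finset.singleton_subset_iff.2 hy)
  have h3 := h2.mul (Realizes.mul hf h1)
  suffices H : (Gate.single y (fourierUnitary d)⁻¹).toMatrix *
      (monomial 1 (fun s : BasisState d W => 2 * Real.pi * (s y * Q s).val / d) *
        (Gate.single y (fourierUnitary d)).toMatrix) =
      monomial (Qudit.addPerm y Q hQ') (fun _ => 0) by
    rw [H] at h3
    exact Realizes.mono h3 (by omega) le_rfl
  refine Matrix.ext fun z x => ?_
  have hdiag : ∀ (f : BasisState d W → ℝ) (M : Matrix (BasisState d W) (BasisState d W) ℂ) z x,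
      (monomial 1 f * M) z x = Complex.exp (f z * Complex.I) * M z x := by
    intro f M z x
    rw [Matrix.mul_apply, Finset.sum_eq_single z]
    · simp [monomial]
    · intro b _ hb; simp [monomial, Ne.symm hb]
    · simp
  rw [wire_le_mul]
  simp only [hdiag, exp_val_eq_stdAddChar, Function.update_self, hQ']
  have hd0 : (d : ℂ) ≠ 0 := Nat.cast_ne_zero.2 (NeZero.ne d)
  by_cases h : ∀ v, v ≠ y → z v = x v
  · have hzx : Q z = Q x := hQ fun v hv => h v (Finset.ne_of_mem_erase hv)
    have hs : ((Real.sqrt d : ℝ) : ℂ)⁻¹ * ((Real.sqrt d : ℝ) : ℂ)⁻¹ = (d : ℂ)⁻¹ := by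
      rw [← mul_inv, ← Complex.ofReal_mul, Real.mul_self_sqrt (Nat.cast_nonneg d)]
      simp
    have : ∀ k : ZMod d, ((fourierUnitary d)⁻¹).1 (z y) k * (stdAddChar (k * Q z) *
        (Gate.single y (fourierUnitary d)).toMatrix (Function.update z y k) x) =
        (d : ℂ)⁻¹ * stdAddChar (k * (x y + Q x - z y)) := by
      intro k
      have e : (Gate.single y (fourierUnitary d)).toMatrix (Function.update z y k) x =
          ((Real.sqrt d : ℝ) : ℂ)⁻¹ * stdAddChar (k * x y) := by
        simp only [Gate.toMatrix]
        rw [if_pos fun v hv => by rw [Function.update_of_ne hv, h v hv]]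
        simp [fourierUnitary]
      have e' : ((fourierUnitary d)⁻¹).1 (z y) k =
          ((Real.sqrt d : ℝ) : ℂ)⁻¹ * stdAddChar (-(k * z y)) := by
        rw [Matrix.UnitaryGroup.inv_val, Matrix.star_apply]
        simp only [fourierUnitary, Matrix.of_apply]
        rw [star_mul', RCLike.star_def, ← AddChar.map_neg_eq_conj, map_inv₀,
          Complex.conj_ofReal]
      rw [e, e', hzx, ← hs, show k * (x y + Q x - z y) = -(k * z y) + (k * Q x + k * x y) by ring,
        AddChar.map_add_eq_mul, AddChar.map_add_eq_mul]
      ring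
    simp only [this, ← Finset.mul_sum]
    rw [AddChar.sum_mulShift _ (ZMod.isPrimitive_stdAddChar d)]
    by_cases hz : z y = x y + Q x
    · have : z = Qudit.addPerm y Q hQ' x := by
        funext v
        by_cases hv : v = y
        · subst hv; simp [Qudit.addPerm, hz]
        · simp [Qudit.addPerm, hv, h v hv]
      simp [monomial, this, hd0, Qudit.addPerm]
    · have : z ≠ Qudit.addPerm y Q hQ' x := fun e => hz (by rw [e]; simp [Qudit.addPerm])
      rw [if_neg (by rw [sub_eq_zero]; exact Ne.symm hz)]
      simp [monomial, this]
  · have : z ≠ Qudit.addPerm y Q hQ' x := fun e => h fun v hv => by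
      rw [e]; simp [Qudit.addPerm, hv]
    simp only [monomial, this, if_false]
    refine Finset.sum_eq_zero fun k _ => ?_
    have e : (Gate.single y (fourierUnitary d)).toMatrix (Function.update z y k) x = 0 := by
      simp only [Gate.toMatrix]
      rw [if_neg]
      intro H
      exact h fun v hv => by rw [← H v hv, Function.update_of_ne hv]
    rw [e, mul_zero, mul_zero]

end

section

variable {d : ℕ} [NeZero d] {W : Type} [DecidableEq W] [Fintype W]

/-! ### Circuits without ancillary wires -/

theorem addPerm_apply (y : W) (Q : BasisState d W → ZMod d)
    (hQ : ∀ s c, Q (Function.update s y c) = Q s) (s : BasisState d W) :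
    addPerm y Q hQ s = Function.update s y (s y + Q s) := rfl

/-- The wires `L`, `R` of a table hold data. If the table is run before and, with the opposite
phases, after the wire `y` has been incremented in those states where the wires `L` and `R` hold
the values `κ`, then all phases cancel in the other states. -/
theorem exists_peel_in_place (hd : 2 ≤ d) {B k k' Q Q' : ℕ} (V : Finset W)
    (hV : V.card = 2 * B + 1 + (k + k')) (hQ : d ^ k ≤ Q * B) (hQ' : d ^ k' ≤ Q' * B)
    (f : BasisState d W → ℝ) (hf : DependsOn f (V : Set W)) :
    ∃ y ∈ V, ∃ f₀ f₁ : BasisState d W → ℝ, f = f₀ + f₁ ∧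
      DependsOn f₀ ((V.erase y : Finset W) : Set W) ∧
      Phase (d ^ (2 * B) * (2 * (Q * Q' * (106 * (B + (1 + (k + k'))))) +
        4 * (100 * (2 * B + 1) * d ^ (2 * B) + 2))) V f₁ := by
  classical
  obtain ⟨p, hpc, hp⟩ := exists_complete_cheap hd
  have hcard : Fintype.card ((Unit ⊕ (Fin k ⊕ Fin k')) ⊕ (Fin B ⊕ Fin B)) = Fintype.card V := by
    simp [hV]; ring
  let e := Fintype.equivOfCardEq hcard
  let φ : (Unit ⊕ (Fin k ⊕ Fin k')) ⊕ (Fin B ⊕ Fin B) → W := fun i => e i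
  have hφ : Function.Injective φ := Subtype.val_injective.comp e.injective
  have hφV : ∀ i, φ i ∈ V := fun i => (e i).2
  have hVφ : ∀ v ∈ V, ∃ i, φ i = v := fun v hv => ⟨e.symm ⟨v, hv⟩, by simp [φ]⟩
  let y : W := φ (.inl (.inl ()))
  have hne : ∀ i, i ≠ .inl (.inl ()) → φ i ≠ y := fun i hi h => hi (hφ h)
  obtain ⟨γ, a, b, htab⟩ := Phase.table (d := d) (G := 1) (T := Q * Q') (fun _ => φ)
    (fun i j x z h => ⟨Subsingleton.elim _ _, hφ h⟩) V (fun _ => hφV)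
    (fun (K : Fin k → ZMod d) => Sum.elim (fun _ => id) (Sum.elim (fun l => p (K l)) 0))
    (fun (K : Fin k' → ZMod d) => Sum.elim 0 (Sum.elim 0 (fun l => p (K l))))
    (by
      rintro K (_ | _ | _)
      exacts [Or.inr (Or.inl rfl), hpc _, Or.inl rfl])
    (by
      rintro K (_ | _ | _)
      exacts [Or.inl rfl, Or.inl rfl, hpc _])
    (by simpa using hQ) (by simpa using hQ') (by simp)
  -- The argument of the phases of the table, and the function realized by the table.
  let arg : (Fin k → ZMod d) → (Fin k' → ZMod d) → BasisState d W → ZMod d := fun i j s =>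
    s (φ (.inr (.inl (a i)))) + s (φ (.inr (.inr (b j)))) +
      (s y + (∑ l, p (i l) (s (φ (.inl (.inr (.inl l))))) +
        ∑ l, p (j l) (s (φ (.inl (.inr (.inr l)))))))
  have hphase : ∀ g : (Fin k → ZMod d) → (Fin k' → ZMod d) → ZMod d → ℝ,
      Phase (Q * Q' * (106 * (B + (1 + (k + k'))))) V
        (fun s : BasisState d W => ∑ i, ∑ j, g i j (arg i j s)) := by
    intro g
    convert htab g using 1
    · simp
    · funext s
      refine Finset.sum_congr rfl fun i _ => Finset.sum_congr rfl fun j _ => ?_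
      congr 1
      simp only [arg, Fintype.sum_sum_type, Sum.elim_inl, Sum.elim_inr, Pi.zero_apply,
        Finset.sum_const_zero, Finset.univ_unique, Finset.sum_singleton, id, y]
      simp only [PUnit.default_eq_unit]
      ring
  -- The state of the wires in `V` with the values `κ` on `L`, `R`, the value `c` on `y`, and `x` on
  -- the wires of the words.
  let state : (Fin B ⊕ Fin B → ZMod d) → ZMod d → (Fin k → ZMod d) × (Fin k' → ZMod d) →
      BasisState d W := fun κ c x => Function.extend φ
        (Sum.elim (Sum.elim (fun _ => c) (Sum.elim x.1 x.2)) κ) 0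
  choose f₀ h hf₀ using fun κ => (((hp.pi (ρ := Fin k)).prod (hp.pi (ρ := Fin k'))).leading
    fun c x => f (state κ c x))
  let κs : BasisState d W → Fin B ⊕ Fin B → ZMod d := fun s c => s (φ (.inr c))
  let xs : BasisState d W → (Fin k → ZMod d) × (Fin k' → ZMod d) := fun s =>
    (fun l => s (φ (.inl (.inr (.inl l)))), fun l => s (φ (.inl (.inr (.inr l)))))
  have hstate : ∀ s, f s = f (state (κs s) (s y) (xs s)) := by
    intro s
    refine hf fun v hv => ?_
    obtain ⟨i, rfl⟩ := hVφ v hv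
    simp only [state, hφ.extend_apply]
    rcases i with (_ | _ | _) | _ <;> rfl
  -- The wires `L`, `R` and the incremented wire.
  let V' : Finset W := insert y (Finset.univ.image fun c => φ (.inr c))
  have hyim : y ∉ Finset.univ.image fun c => φ (.inr c) := by
    intro hy
    obtain ⟨c, -, hc⟩ := Finset.mem_image.1 hy
    exact hne _ (by simp) hc
  have hV' : V'.card = 2 * B + 1 := by
    rw [Finset.card_insert_of_notMem hyim, Finset.card_image_of_injective _
      (show Function.Injective fun c => φ (.inr c) from hφ.comp Sum.inr_injective)]
    simp; ring
  have hV'V : V' ⊆ V := by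
    refine Finset.insert_subset (hφV _) fun v hv => ?_
    obtain ⟨c, -, rfl⟩ := Finset.mem_image.1 hv
    exact hφV _
  let q : (Fin B ⊕ Fin B → ZMod d) → BasisState d W → ZMod d := fun κ s =>
    if κs s = κ then 1 else 0
  have hmove : ∀ κ, ∃ hh, Moves (100 * (2 * B + 1) * d ^ (2 * B) + 2) V (addPerm y (q κ) hh) := by
    intro κ
    obtain ⟨hh, hm⟩ := Moves.addPerm hd hV' (Finset.mem_insert_self _ _) (q κ) (by
      intro s s' hs
      have : κs s = κs s' := funext fun c => hs _ (by
        simp only [V', Finset.erase_insert hyim, Finset.coe_image, Finset.coe_univ]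
        exact ⟨c, trivial, rfl⟩)
      simp only [q, this])
    exact ⟨hh, Realizes.mono hm le_rfl hV'V⟩
  choose hh hm using hmove
  -- For the value `κ` of the wires `L`, `R` the known contribution of these wires is subtracted.
  let g : (Fin B ⊕ Fin B → ZMod d) → (Fin k → ZMod d) → (Fin k' → ZMod d) → ZMod d → ℝ :=
    fun κ i j z => h κ (i, j) (z - κ (.inl (a i)) - κ (.inr (b j)))
  let ψ : (Fin B ⊕ Fin B → ZMod d) → BasisState d W → ℝ := fun κ s =>
    ∑ i, ∑ j, g κ i j (arg i j s) - ∑ i, ∑ j, g κ i j (arg i j (addPerm y (q κ) (hh κ) s))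
  have hψ : ∀ κ, Phase (2 * (Q * Q' * (106 * (B + (1 + (k + k'))))) +
        4 * (100 * (2 * B + 1) * d ^ (2 * B) + 2)) V (ψ κ) := by
    intro κ
    have h1 := hphase (g κ)
    have h2 := (hphase fun i j z => - g κ i j z).conj (hm κ)
    have h3 := Phase.schedulable.add h1 h2
    convert Phase.schedulable.mono h3 (le_of_eq _) le_rfl using 1
    · funext s
      simp [ψ, sub_eq_add_neg]
    · ring
  have hψ0 : ∀ κ s, κs s ≠ κ → ψ κ s = 0 := by
    intro κ s hs
    simp only [ψ, addPerm_apply, q, if_neg hs, add_zero, Function.update_eq_self, sub_self]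
  have hψ1 : ∀ s, ψ (κs s) s = f s - f₀ (κs s) (xs s) := by
    intro s
    have harg : ∀ i j, arg i j s - κs s (.inl (a i)) - κs s (.inr (b j)) =
        s y + (∑ l, p (i l) ((xs s).1 l) + ∑ l, p (j l) ((xs s).2 l)) := by
      intro i j; simp only [arg, κs, xs]; ring
    have harg' : ∀ i j, arg i j (addPerm y (q (κs s)) (hh (κs s)) s) = arg i j s + 1 := by
      intro i j
      simp only [addPerm_apply, arg, q, if_true, Function.update_self]
      rw [Function.update_of_ne (hne _ (by simp)), Function.update_of_ne (hne _ (by simp))]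
      have e1 : ∀ l, Function.update s y (s y + 1) (φ (.inl (.inr l))) = s (φ (.inl (.inr l))) :=
        fun l => Function.update_of_ne (hne _ (by simp)) _ _
      simp only [e1]
      ring
    have harg'' : ∀ i j, arg i j (addPerm y (q (κs s)) (hh (κs s)) s) - κs s (.inl (a i)) -
        κs s (.inr (b j)) =
        s y + (∑ l, p (i l) ((xs s).1 l) + ∑ l, p (j l) ((xs s).2 l)) + 1 := by
      intro i j; rw [harg', ← harg]; ring
    rw [hstate s, hf₀, add_sub_cancel_left, Fintype.sum_prod_type]
    simp only [ψ, g, harg, harg'', Finset.sum_sub_distrib]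
  have hsum := (Phase.schedulable (d := d) (W := W)).sum
    (T := Fintype.card (Fin B ⊕ Fin B → ZMod d)) (Fintype.equivFin _) (fun _ => V) V
    (fun _ => le_rfl) (fun i j hij e => absurd ((Fintype.equivFin _).injective e) hij) ψ hψ
  refine ⟨y, hφV _, fun s => f₀ (κs s) (xs s), ∑ κ, ψ κ, ?_, ?_, ?_⟩
  · funext s
    rw [Pi.add_apply, Finset.sum_apply, Finset.sum_eq_single (κs s)]
    · rw [hψ1]; ring
    · intro κ _ hκ; exact hψ0 κ s hκ.symm
    · simp
  · intro s s' hs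
    have h1 : ∀ i, i ≠ .inl (.inl ()) → s (φ i) = s' (φ i) := fun i hi =>
      hs _ (Finset.mem_coe.2 (Finset.mem_erase.2 ⟨hne i hi, hφV i⟩))
    have h2 : κs s = κs s' := funext fun c => h1 _ (by simp)
    have h3 : xs s = xs s' := Prod.ext (funext fun l => h1 _ (by simp))
      (funext fun l => h1 _ (by simp))
    simp only [h2, h3]
  · convert hsum using 2
    simp [two_mul]

theorem succ_sq_le_three_mul_two_pow (h : ℕ) : (h + 1) ^ 2 ≤ 3 * 2 ^ h := by
  induction h with
  | zero => norm_num
  | succ h ih =>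
    rcases lt_or_ge h 2 with h2 | h2
    · interval_cases h <;> norm_num
    · rw [pow_succ 2 h]; nlinarith

theorem ceil_block {N B : ℕ} (hB : 0 < B) (hBN : B ≤ N) :
    N ≤ ((N + B - 1) / B) * B ∧ ((N + B - 1) / B) * B ≤ 2 * N := by
  have h1 := Nat.div_add_mod (N + B - 1) B
  have h2 := Nat.mod_lt (N + B - 1) hB
  have h3 : B * ((N + B - 1) / B) = ((N + B - 1) / B) * B := mul_comm _ _
  omega

/-- Without ancillary wires every function of `n + 1` wires is realized as a phase in depth
`O(d ^ n / (n + 1))`. -/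
theorem Phase.of_dependsOn_in_place (hd : 2 ≤ d) (n : ℕ) : ∀ (V : Finset W), V.card = n + 1 →
    ∀ f : BasisState d W → ℝ, DependsOn f (V : Set W) →
      ∃ D, (n + 1) * D ≤ 700000 * d ^ n ∧ Phase D V f := by
  induction n with
  | zero =>
    intro V hV f hf
    exact ⟨_, by norm_num, Phase.of_dependsOn hd 0 V hV f hf⟩
  | succ n ih =>
    intro V hV f hf
    rcases lt_or_ge n 7 with hn | hn
    · refine ⟨_, ?_, Phase.of_dependsOn hd (n + 1) V hV f hf⟩
      have : (n + 1 + 1) * (n + 1 + 1) ≤ 8 * 8 := Nat.mul_le_mul (by omega) (by omega)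
      calc (n + 1 + 1) * (100 * (n + 1 + 1) * d ^ (n + 1))
          = ((n + 1 + 1) * (n + 1 + 1)) * (100 * d ^ (n + 1)) := by ring
        _ ≤ (8 * 8) * (100 * d ^ (n + 1)) := Nat.mul_le_mul_right _ this
        _ ≤ 700000 * d ^ (n + 1) := by rw [← mul_assoc]; exact Nat.mul_le_mul_right _ (by norm_num)
    · set N := n + 2 with hN
      -- With an eighth of the wires in each of `L` and `R`, the controlled increments, which cost
      -- about `B * d ^ (4 * B)`, are cheap compared with `d ^ (n + 1) / N`.
      obtain ⟨B, hB⟩ : ∃ B, B = N / 8 := ⟨_, rfl⟩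
      obtain ⟨K, hK⟩ : ∃ K, K = N - 1 - 2 * B := ⟨_, rfl⟩
      obtain ⟨k, hk⟩ : ∃ k, k = K / 2 := ⟨_, rfl⟩
      obtain ⟨k', hk'⟩ : ∃ k', k' = K - k := ⟨_, rfl⟩
      have hB0 : 0 < B := by omega
      have two_le : ∀ j, 2 ^ j ≤ d ^ j := fun j => Nat.pow_le_pow_left hd j
      have hBk : B ≤ d ^ k :=
        le_trans (by omega) (le_trans (Nat.lt_two_pow_self (n := k)).le (two_le k))
      have hBk' : B ≤ d ^ k' :=
        le_trans (by omega) (le_trans (Nat.lt_two_pow_self (n := k')).le (two_le k'))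
      obtain ⟨q1, q2⟩ := ceil_block hB0 hBk
      obtain ⟨q1', q2'⟩ := ceil_block hB0 hBk'
      obtain ⟨Q, hQ⟩ : ∃ Q, Q = (d ^ k + B - 1) / B := ⟨_, rfl⟩
      obtain ⟨Q', hQ'⟩ : ∃ Q', Q' = (d ^ k' + B - 1) / B := ⟨_, rfl⟩
      rw [← hQ] at q1 q2
      rw [← hQ'] at q1' q2'
      obtain ⟨y, hy, f₀, f₁, hff, hf₀, hf₁⟩ := exists_peel_in_place hd V (B := B) (k := k)
        (k' := k') (by omega) q1 q1' f hf
      obtain ⟨D₀, hD₀, hp₀⟩ := ih (V.erase y) (by rw [Finset.card_erase_of_mem hy]; omega) f₀ hf₀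
      have hp := Phase.schedulable.add
        (Phase.schedulable.mono hp₀ le_rfl (Finset.erase_subset y V)) hf₁
      refine ⟨_, ?_, hff ▸ hp⟩
      have hKk : k + k' = K := by omega
      -- the cost of the table
      have t1 : N * (d ^ (2 * B) * (2 * (Q * Q' * (106 * (B + (1 + (k + k'))))))) ≤
          217088 * d ^ (n + 1) := by
        have e1 : N ≤ 16 * B := by omega
        have e2 : B + (1 + (k + k')) ≤ 16 * B := by omega
        have e3 : (Q * B) * (Q' * B) ≤ (2 * d ^ k) * (2 * d ^ k') := Nat.mul_le_mul q2 q2'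
        have e4 : d ^ (n + 1) = d ^ (2 * B) * (d ^ k * d ^ k') := by
          rw [← pow_add, ← pow_add]; congr 1; omega
        calc N * (d ^ (2 * B) * (2 * (Q * Q' * (106 * (B + (1 + (k + k')))))))
            ≤ (16 * B) * (d ^ (2 * B) * (2 * (Q * Q' * (106 * (16 * B))))) := by gcongr
          _ = 54272 * d ^ (2 * B) * ((Q * B) * (Q' * B)) := by ring
          _ ≤ 54272 * d ^ (2 * B) * ((2 * d ^ k) * (2 * d ^ k')) := by gcongr
          _ = 217088 * d ^ (n + 1) := by rw [e4]; ring
      -- the cost of the controlled increments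
      have t2 : N * (d ^ (2 * B) * (4 * (100 * (2 * B + 1) * d ^ (2 * B) + 2))) ≤
          5000 * d ^ (n + 1) := by
        obtain ⟨h, hh⟩ : ∃ h, h = N - 1 - 4 * B := ⟨_, rfl⟩
        have e1 : N ^ 2 ≤ 12 * d ^ h := by
          calc N ^ 2 ≤ (2 * (h + 1)) ^ 2 := Nat.pow_le_pow_left (by omega) 2
            _ = 4 * (h + 1) ^ 2 := by ring
            _ ≤ 4 * (3 * 2 ^ h) := Nat.mul_le_mul_left _ (succ_sq_le_three_mul_two_pow h)
            _ ≤ 4 * (3 * d ^ h) := by gcongr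
            _ = 12 * d ^ h := by ring
        have e2 : 2 ≤ 2 * (2 * B + 1) * d ^ (2 * B) := by
          have := Nat.pos_of_ne_zero (pow_ne_zero (2 * B) (NeZero.ne d))
          nlinarith
        have e3 : d ^ (n + 1) = d ^ (2 * B) * (d ^ (2 * B) * d ^ h) := by
          rw [← pow_add, ← pow_add]; congr 1; omega
        calc N * (d ^ (2 * B) * (4 * (100 * (2 * B + 1) * d ^ (2 * B) + 2)))
            ≤ N * (d ^ (2 * B) * (4 * (100 * (2 * B + 1) * d ^ (2 * B) +
              2 * (2 * B + 1) * d ^ (2 * B)))) := by gcongr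
          _ = 408 * (N * (2 * B + 1)) * (d ^ (2 * B) * d ^ (2 * B)) := by ring
          _ ≤ 408 * (N * N) * (d ^ (2 * B) * d ^ (2 * B)) := by gcongr; omega
          _ = 408 * N ^ 2 * (d ^ (2 * B) * d ^ (2 * B)) := by ring
          _ ≤ 408 * (12 * d ^ h) * (d ^ (2 * B) * d ^ (2 * B)) := by gcongr
          _ = 4896 * d ^ (n + 1) := by rw [e3]; ring
          _ ≤ 5000 * d ^ (n + 1) := by gcongr; norm_num
      -- the cost of the remaining function
      have t3 : 3 * (N * D₀) ≤ 2 * (700000 * d ^ (n + 1)) := by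
        have e1 : 3 * N ≤ 4 * (n + 1) := by omega
        have e2 : 2 * d ^ n ≤ d ^ (n + 1) := by
          rw [pow_succ, mul_comm]; exact Nat.mul_le_mul_left _ hd
        calc 3 * (N * D₀) = 3 * N * D₀ := by ring
          _ ≤ 4 * (n + 1) * D₀ := by gcongr
          _ = 4 * ((n + 1) * D₀) := by ring
          _ ≤ 4 * (700000 * d ^ n) := by gcongr
          _ = 2 * 700000 * (2 * d ^ n) := by ring
          _ ≤ 2 * 700000 * d ^ (n + 1) := by gcongr
          _ = _ := by ring
      rw [mul_add, mul_add (d ^ (2 * B)), mul_add N]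
      omega

end

section

variable {d : ℕ} [NeZero d] {W : Type} [DecidableEq W] [Fintype W]

/-! ### Circuits with ancillary wires -/

theorem ShearOnto.sum {a b : W} (hab : a ≠ b) {T : Finset W} (ha : a ∉ T) (hb : b ∈ T) :
    ShearOnto T 1 {a, b} (fun s : BasisState d W => Pi.single b (s a)) := by
  refine ⟨⟨sumPerm a b hab, fun s => sumPerm_apply a b hab s, Realizes.sumPerm a b hab⟩,
    fun s w hw => Pi.single_eq_of_ne (by rintro rfl; exact hw hb) _, fun s s' h => ?_⟩
  simp only [h a ha]

/-- The register `x 0` is copied to the registers `x 1`, …, `x G`, whose number doubles in each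
layer. -/
theorem exists_copies {ρ : Type} [Fintype ρ] {G : ℕ} (x : Fin (G + 1) → ρ → W)
    (hx : ∀ i j l l', x i l = x j l' → i = j ∧ l = l') (U : Finset W) (hU : ∀ i l, x i l ∈ U)
    (r : ℕ) : ∃ σ : Equiv.Perm (BasisState d W), Moves r U σ ∧
      ∀ s, (∀ i l, i ≠ 0 → s (x i l) = 0) →
        (∀ (i : Fin (G + 1)) l, (i : ℕ) < 2 ^ r → σ s (x i l) = s (x 0 l)) ∧
        ∀ w, (∀ (i : Fin (G + 1)) l, (i : ℕ) < 2 ^ r → w ≠ x i l) → σ s w = s w := by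
  classical
  induction r with
  | zero =>
    refine ⟨1, ?_, fun s _ => ⟨fun i l hi => ?_, fun w _ => rfl⟩⟩
    · have := Realizes.one (d := d) U
      rw [← monomial_one_zero] at this
      exact this
    · have : i = 0 := Fin.ext (by simpa using hi)
      rw [this]; rfl
  | succ r ih =>
    obtain ⟨σ, hσ, hσs⟩ := ih
    -- The layer copies register `i - 2 ^ r` to register `i`.
    let J := {i : Fin (G + 1) // 2 ^ r ≤ (i : ℕ) ∧ (i : ℕ) < 2 ^ (r + 1)} × ρ
    let src : J → W := fun j => x ⟨j.1.1 - 2 ^ r, lt_of_le_of_lt (Nat.sub_le _ _) j.1.1.2⟩ j.2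
    let tgt : J → W := fun j => x j.1.1 j.2
    let T : Finset W := Finset.univ.image tgt
    have htgt : Function.Injective tgt := fun j j' h => by
      obtain ⟨h1, h2⟩ := hx _ _ _ _ h
      exact Prod.ext (Subtype.ext h1) h2
    have hsrc : Function.Injective src := fun j j' h => by
      obtain ⟨h1, h2⟩ := hx _ _ _ _ h
      have h1 := Fin.mk.inj_iff.1 h1
      have := j.1.2
      have := j'.1.2
      exact Prod.ext (Subtype.ext (Fin.ext (by omega))) h2
    have hst : ∀ j j', src j ≠ tgt j' := fun j j' h => by
      obtain ⟨h1, h2⟩ := hx _ _ _ _ h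
      have h1 := congrArg Fin.val h1
      have := j.1.2
      have := j'.1.2
      have := pow_succ 2 r
      simp only at h1
      omega
    have hstep := (ShearOnto.schedulable (d := d) T).sum (J := J) (T := 1) (c := 1)
      (fun _ => 0) (fun j => {src j, tgt j}) U
      (fun j => by simp [Finset.insert_subset_iff, src, tgt, hU])
      (fun i j hij _ => by
        simp [hsrc.ne hij.symm, htgt.ne hij.symm, hst, (hst _ _).symm])
      (fun j s => Pi.single (tgt j) (s (src j)))
      (fun j => ShearOnto.sum (hst j j) (by simp [T, (hst _ _).symm]) (by simp [T]))
    obtain ⟨⟨τ, hτ, hτm⟩, -⟩ := hstep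
    refine ⟨τ * σ, by simpa using hτm.mul hσ, fun s hs => ?_⟩
    obtain ⟨h1, h2⟩ := hσs s hs
    have hτ0 : ∀ w, (∀ j, w ≠ tgt j) → τ (σ s) w = σ s w := by
      intro w hw
      rw [hτ, Pi.add_apply, Finset.sum_apply, Finset.sum_apply, Finset.sum_eq_zero, add_zero]
      intro j _
      exact Pi.single_eq_of_ne (hw j) _
    constructor
    · intro i l hi
      rw [Equiv.Perm.mul_apply]
      rcases lt_or_ge (i : ℕ) (2 ^ r) with hir | hir
      · rw [hτ0, h1 i l hir]
        intro j h
        have h3 := congrArg Fin.val (hx _ _ _ _ h).1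
        have := j.1.2
        omega
      · let j : J := (⟨i, hir, hi⟩, l)
        rw [hτ, Pi.add_apply, Finset.sum_apply, Finset.sum_apply, Finset.sum_eq_single j]
        · have e1 : σ s (x i l) = 0 := by
            rw [h2, hs]
            · rintro rfl
              have := Nat.two_pow_pos r
              simp at hir
            · intro i' l' hi' h
              have h3 := congrArg Fin.val (hx _ _ _ _ h).1
              omega
          have e2 : σ s (src j) = s (x 0 l) := h1 _ _ (by
            have := pow_succ 2 r
            change (i : ℕ) - 2 ^ r < 2 ^ r
            omega)
          rw [e1, zero_add, ← e2]
          exact Pi.single_eq_same _ _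
        · intro j' _ hj'
          exact Pi.single_eq_of_ne (htgt.ne hj'.symm : tgt j ≠ tgt j') _
        · simp
    · intro w hw
      rw [Equiv.Perm.mul_apply, hτ0, h2]
      · exact fun i l hi => hw i l (hi.trans (Nat.pow_lt_pow_right (by norm_num) (by omega)))
      · exact fun j => hw _ _ j.1.2.2

theorem complete_unit : Complete fun (_ : Unit) (_ : Unit) => (0 : ZMod d) := by
  refine Complete.of_coeff fun j _ x₀ => ⟨fun _ => 1, fun x => ?_⟩
  simp [Subsingleton.elim x x₀]

/-- Every function of the data wires `β` is realized as a phase with the help of `G` groups of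
ancillary wires, each of which holds a copy of the data and the wires of a table. -/
theorem exists_phase_ancilla (hd : 2 ≤ d) {n₁ n₂ G Q Q' T r : ℕ} (hn₁ : 1 ≤ n₁)
    (hB : 1 ≤ n₂)
    (β : Fin n₁ ⊕ Fin n₂ → W)
    (α : Fin G → (Fin n₁ ⊕ Fin n₂) ⊕ (Fin n₂ ⊕ Fin n₂) → W) (hβ : Function.Injective β)
    (hα : ∀ i j x y, α i x = α j y → i = j ∧ x = y) (hαβ : ∀ i x l, α i x ≠ β l) (U : Finset W)
    (hUα : ∀ i x, α i x ∈ U) (hUβ : ∀ l, β l ∈ U) (hr : G + 1 ≤ 2 ^ r) (hQ : d ^ n₁ ≤ Q * n₂)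
    {ι : Type} [Fintype ι] (w : ι → Fin n₂ → ZMod d → ZMod d) (hw : ∀ i l, IsCheap (w i l))
    (hgen : Generating w) (hQ' : Fintype.card ι ≤ Q' * n₂) (hQ'0 : 1 ≤ Q') (hT : Q * Q' ≤ T * G)
    (f : (Fin n₁ ⊕ Fin n₂ → ZMod d) → ℝ) :
    ∃ F : BasisState d W → ℝ,
      Phase (4 * r + (3 * T * (106 * (n₂ + (n₁ + n₂))) + 1)) U F ∧
      ∀ s, (∀ i x, s (α i x) = 0) → F s = f fun l => s (β l) := by
  obtain ⟨p, hpc, hp⟩ := exists_complete_cheap hd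
  obtain ⟨ι₁, _, w₁, hw₁, hgen₁, hcard₁, -, -⟩ := exists_generating hd n₁
  obtain ⟨f₀, g, hfg⟩ := hgen (Fin n₁ → ZMod d) (Fin n₁ → ZMod d)
    (fun k y => ∑ l, p (k l) (y l)) (hp.pi (ρ := Fin n₁)) fun y x => f (Sum.elim y x)
  -- The rest `f₀`, which depends on the first `n₁` wires only, gets a second table.
  obtain ⟨c, g₁, hfg₁⟩ := hgen₁ Unit Unit _ complete_unit fun _ y => f₀ y
  obtain ⟨γ, a, b, htab⟩ := Phase.table (d := d) (T := T) α hα U hUα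
    (fun (K : Fin n₁ → ZMod d) => Sum.elim (fun l => p (K l)) 0) (fun i => Sum.elim 0 (w i))
    (by rintro K (_ | _); exacts [hpc _, Or.inl rfl])
    (by rintro K (_ | _); exacts [Or.inl rfl, hw _ _]) (by simpa using hQ) hQ' hT
  obtain ⟨γ₁, a₁, b₁, htab₁⟩ := Phase.table (d := d) (T := 2 * T) (Q := 2 * Q) (Q' := 1)
    (ι' := Unit) α hα U hUα
    (fun i => Sum.elim (w₁ i) 0) (fun _ => 0)
    (by rintro K (_ | _); exacts [hw₁ _ _, Or.inl rfl])
    (fun _ _ => Or.inl rfl) (by rw [mul_assoc]; omega) (by simpa using hB) (by nlinarith)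
  have h0 := htab g
  have h1 := htab₁ fun i _ => g₁ () i
  have h2 : Phase 1 U (fun _ : BasisState d W => c ()) :=
    Phase.schedulable.mono (Phase.wire (β (.inl ⟨0, hn₁⟩)) fun _ => c ()) le_rfl
      (Finset.singleton_subset_iff.2 (hUβ _))
  have h3 := Phase.schedulable.add (Phase.schedulable.add h0 h1) h2
  obtain ⟨σ, hσ, hσs⟩ := exists_copies (d := d) (G := G)
    (Fin.cons β fun i l => α i (.inl l) : Fin (G + 1) → Fin n₁ ⊕ Fin n₂ → W) (by
      intro i j l l'
      refine Fin.cases ?_ (fun i => ?_) i <;> refine Fin.cases ?_ (fun j => ?_) j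
      · intro h; exact ⟨rfl, hβ h⟩
      · intro h; exact absurd h.symm (hαβ _ _ _)
      · intro h; exact absurd h (hαβ _ _ _)
      · intro h
        have h' : α i (.inl l) = α j (.inl l') := h
        exact ⟨congrArg Fin.succ (hα _ _ _ _ h').1, Sum.inl_injective (hα _ _ _ _ h').2⟩) U (by
      intro i l
      refine Fin.cases ?_ (fun i => ?_) i
      exacts [hUβ l, hUα i _]) r
  refine ⟨_, Phase.schedulable.mono (h3.conj hσ) ?_ le_rfl, fun s hs => ?_⟩
  · simp only [Fintype.card_sum, Fintype.card_fin]
    apply le_of_eq; ring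
  · obtain ⟨h4, h5⟩ := hσs s (by
      intro i l
      refine Fin.cases ?_ (fun i => ?_) i
      · intro h; exact absurd rfl h
      · intro _; exact hs _ _)
    have e1 : ∀ i l, σ s (α i (.inl l)) = s (β l) := by
      intro i l
      have := h4 i.succ l (lt_of_lt_of_le i.succ.2 hr)
      simpa using this
    have e2 : ∀ i z, σ s (α i (.inr z)) = 0 := by
      intro i z
      rw [h5, hs]
      intro j l _
      refine Fin.cases ?_ (fun j => ?_) j
      · exact hαβ _ _ _
      · intro h; simpa using (hα _ _ _ _ h).2
    have e3 : (fun l => s (β l)) = Sum.elim (fun l => s (β (.inl l))) fun l => s (β (.inr l)) := by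
      funext l; cases l <;> rfl
    have e4 := hfg (fun l => s (β (.inl l))) fun l => s (β (.inr l))
    have e5 := hfg₁ () fun l => s (β (.inl l))
    rw [e3, e4, e5]
    simp [e1, e2, Fintype.sum_sum_type]
    ring

end

section

variable {d : ℕ} [NeZero d] {W : Type} [DecidableEq W] [Fintype W]

/-! ### The upper bound -/

theorem Gate.support_nonempty (g : Gate d W) : g.support.Nonempty := by
  cases g <;> simp [Gate.support]

theorem length_le_card_of_meets : ∀ (gs : List (Gate d W)),
    (gs.Pairwise fun g h => Disjoint g.support h.support) → ∀ U : Finset W,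
    (∀ g ∈ gs, ¬ Disjoint g.support U) → gs.length ≤ U.card
  | [], _, U, _ => by simp
  | g :: gs, hgs, U, hU => by
    rw [List.pairwise_cons] at hgs
    have h1 := length_le_card_of_meets gs hgs.2 (U \ g.support) fun h hh hd =>
      hU h (List.mem_cons_of_mem _ hh) <| by
        refine (hd.sup_right (hgs.1 h hh).symm).mono_right fun v hv => ?_
        by_cases hg : v ∈ g.support <;> simp [hg, hv]
    have h2 : (U \ g.support).card < U.card := by
      obtain ⟨v, hv, hvU⟩ := Finset.not_disjoint_iff.1 (hU g List.mem_cons_self)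
      exact Finset.card_lt_card <| Finset.sdiff_subset.ssubset_of_mem_notMem hvU (by simp [hv])
    rw [List.length_cons]
    omega

theorem Circuit.size_le {c : Circuit d W} {U : Finset W} (hc : Circuit.SupportedOn c U) :
    Circuit.size c ≤ Circuit.depth c * U.card := by
  have := List.sum_le_card_nsmul (c.map fun l => l.gates.length) U.card (by
    intro x hx
    obtain ⟨l, hl, rfl⟩ := List.mem_map.1 hx
    refine length_le_card_of_meets l.gates l.disjoint U fun g hg hd => ?_
    exact g.support_nonempty.ne_empty (disjoint_self.1 (hd.mono_right (hc l hl g hg))))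
  simpa [Circuit.size, Circuit.depth] using this

theorem exists_phases {n : ℕ} {U : Matrix (BasisState d (Fin n)) (BasisState d (Fin n)) ℂ}
    (hU : IsDiagonalUnitary U) :
    ∃ f : BasisState d (Fin n) → ℝ, U = Matrix.diagonal fun x => Complex.exp (f x * Complex.I) := by
  obtain ⟨hd, hu⟩ := hU
  refine ⟨fun x => Complex.arg (U x x), ?_⟩
  conv_lhs => rw [← hd.diagonal_diag]
  congr 1
  funext x
  have h1 := congrFun (congrFun (Matrix.mem_unitaryGroup_iff.1 hu) x) x
  rw [Matrix.mul_apply, Finset.sum_eq_single x, Matrix.one_apply_eq, Matrix.star_apply,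
    RCLike.star_def, Complex.mul_conj, Complex.normSq_eq_norm_sq] at h1
  · have h2 : ‖U x x‖ ^ 2 = 1 := by exact_mod_cast h1
    have h3 : ‖U x x‖ = 1 := by
      have := norm_nonneg (U x x)
      nlinarith
    rw [Matrix.diag_apply]
    conv_lhs => rw [← Complex.norm_mul_exp_arg_mul_I (U x x), h3]
    simp
  · intro z _ hz
    rw [hd hz.symm, zero_mul]
  · simp

theorem Phase.exists_circuit {n m D : ℕ} {V : Finset (Fin n ⊕ Fin m)}
    {F : BasisState d (Fin n ⊕ Fin m) → ℝ} (hF : Phase D V F) (f : BasisState d (Fin n) → ℝ)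
    (h : ∀ s, (∀ j, s (.inr j) = 0) → F s = f fun i => s (.inl i)) :
    ∃ c : Circuit d (Fin n ⊕ Fin m),
      Circuit.Implements c (Matrix.diagonal fun x => Complex.exp (f x * Complex.I)) ∧
      Circuit.depth c ≤ D ∧ Circuit.size c ≤ D * V.card := by
  obtain ⟨c, hc1, hc2, hc3⟩ := hF
  refine ⟨c, fun ψ => ?_, hc1, (Circuit.size_le hc2).trans (Nat.mul_le_mul_right _ hc1)⟩
  funext z
  rw [hc3, Matrix.mulVec, dotProduct, Finset.sum_eq_single z]
  · by_cases hz : ∀ j : Fin m, z (.inr j) = 0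
    · simp [monomial, withAncilla, hz, h z hz, Matrix.mulVec_diagonal]
    · simp [withAncilla, hz]
  · intro y _ hy
    simp [monomial, Ne.symm hy]
  · simp

/-- The circuit without ancillary wires. -/
theorem exists_circuit_in_place (hd : 2 ≤ d) (n m : ℕ) (hn : 1 ≤ n)
    (f : BasisState d (Fin n) → ℝ) : ∃ c : Circuit d (Fin n ⊕ Fin m),
      Circuit.Implements c (Matrix.diagonal fun x => Complex.exp (f x * Complex.I)) ∧
      n * Circuit.depth c ≤ 700000 * d ^ (n - 1) ∧ Circuit.size c ≤ 700000 * d ^ (n - 1) := by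
  classical
  obtain ⟨k, rfl⟩ : ∃ k, n = k + 1 := ⟨n - 1, by omega⟩
  have hcard : (Finset.univ.image (Sum.inl : Fin (k + 1) → Fin (k + 1) ⊕ Fin m)).card = k + 1 := by
    rw [Finset.card_image_of_injective _ Sum.inl_injective]; simp
  obtain ⟨D, hD, hp⟩ := Phase.of_dependsOn_in_place hd k _ hcard
    (fun s : BasisState d (Fin (k + 1) ⊕ Fin m) => f fun i => s (.inl i)) (fun s s' hs =>
      congrArg f (funext fun i => hs _ (by simp)))
  obtain ⟨c, h1, h2, h3⟩ := hp.exists_circuit f fun s _ => rfl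
  rw [hcard] at h3
  refine ⟨c, h1, (Nat.mul_le_mul_left _ h2).trans hD, h3.trans ?_⟩
  rw [mul_comm]
  exact hD

/-- The circuit with `G` groups of at most `3 * n` ancillary wires, in terms of `G`. -/
theorem exists_circuit_ancilla (hd : 2 ≤ d) (n m G : ℕ) (hn : 2 ≤ n) (hG : 1 ≤ G)
    (hGm : 3 * n * G ≤ m) (hGd : G < d ^ n) (f : BasisState d (Fin n) → ℝ) :
    ∃ D, n * G * D ≤ 21000 * d ^ (n - 1) + 700 * (n ^ 2 * G * Nat.clog 2 d) ∧
      ∃ c : Circuit d (Fin n ⊕ Fin m),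
        Circuit.Implements c (Matrix.diagonal fun x => Complex.exp (f x * Complex.I)) ∧
        Circuit.depth c ≤ D ∧ Circuit.size c ≤ 4 * (n * G * D) := by
  classical
  obtain ⟨n₁, hn₁⟩ : ∃ n₁, n₁ = n / 2 := ⟨_, rfl⟩
  obtain ⟨n₂, hn₂⟩ : ∃ n₂, n₂ = n - n₁ := ⟨_, rfl⟩
  have two_le : ∀ j, 2 ^ j ≤ d ^ j := fun j => Nat.pow_le_pow_left hd j
  obtain ⟨ι, _, w, hw, hgen, -, hcard, hcard'⟩ := exists_generating hd n₂
  have hlt : n₂ ≤ 2 ^ (n₂ - 1) := by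
    have := Nat.lt_two_pow_self (n := n₂ - 1)
    omega
  have hb : n₂ ≤ d ^ n₁ := hlt.trans ((two_le _).trans (Nat.pow_le_pow_right (by omega) (by omega)))
  have hb' : n₂ ≤ Fintype.card ι := hlt.trans ((two_le _).trans (hcard' (by omega)))
  obtain ⟨q1, q2⟩ := ceil_block (by omega) hb
  obtain ⟨q1', q2'⟩ := ceil_block (by omega) hb'
  obtain ⟨Q, hQ⟩ : ∃ Q, Q = (d ^ n₁ + n₂ - 1) / n₂ := ⟨_, rfl⟩
  obtain ⟨Q', hQ'⟩ : ∃ Q', Q' = (Fintype.card ι + n₂ - 1) / n₂ := ⟨_, rfl⟩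
  rw [← hQ] at q1 q2
  rw [← hQ'] at q1' q2'
  have hQ'0 : 1 ≤ Q' := by
    rcases Nat.eq_zero_or_pos Q' with h | h
    · rw [h] at q1'; omega
    · exact h
  obtain ⟨T, hT⟩ : ∃ T, T = Q * Q' / G + 1 := ⟨_, rfl⟩
  have hT1 : Q * Q' ≤ T * G := by
    have h1 := Nat.div_add_mod (Q * Q') G
    have h2 := Nat.mod_lt (Q * Q') (show G > 0 by omega)
    rw [hT, add_mul, one_mul, mul_comm (Q * Q' / G)]
    omega
  have hT2 : T * G ≤ Q * Q' + G := by
    rw [hT, add_mul, one_mul]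
    exact Nat.add_le_add_right (Nat.div_mul_le_self _ _) _
  let e : Fin n₁ ⊕ Fin n₂ ≃ Fin n := Fintype.equivOfCardEq (by simp; omega)
  obtain ⟨α⟩ : Nonempty (Fin G × ((Fin n₁ ⊕ Fin n₂) ⊕ (Fin n₂ ⊕ Fin n₂)) ↪ Fin m) := by
    refine Function.Embedding.nonempty_of_card_le ?_
    simp only [Fintype.card_prod, Fintype.card_sum, Fintype.card_fin]
    calc G * (n₁ + n₂ + (n₂ + n₂)) ≤ G * (3 * n) := Nat.mul_le_mul_left _ (by omega)
      _ = 3 * n * G := by ring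
      _ ≤ m := hGm
  let U : Finset (Fin n ⊕ Fin m) := Finset.univ.image Sum.inl ∪
    Finset.univ.image fun x => Sum.inr (α x)
  have hUcard : U.card ≤ 4 * (n * G) := by
    refine (Finset.card_union_le _ _).trans ((add_le_add Finset.card_image_le
      Finset.card_image_le).trans ?_)
    simp only [Finset.card_univ, Fintype.card_prod, Fintype.card_sum, Fintype.card_fin]
    have h1 : G * (n₁ + n₂ + (n₂ + n₂)) ≤ G * (3 * n) := Nat.mul_le_mul_left _ (by omega)
    nlinarith
  have hr : G + 1 ≤ 2 ^ (n * Nat.clog 2 d) := by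
    calc G + 1 ≤ d ^ n := hGd
      _ ≤ (2 ^ Nat.clog 2 d) ^ n := Nat.pow_le_pow_left (Nat.le_pow_clog (by norm_num) d) n
      _ = 2 ^ (n * Nat.clog 2 d) := by rw [← pow_mul, mul_comm]
  obtain ⟨F, hF, hF'⟩ := exists_phase_ancilla hd (by omega) (by omega) (fun l => Sum.inl (e l))
    (fun i x => Sum.inr (α (i, x))) (Sum.inl_injective.comp e.injective)
    (fun i j x y h => by
      have := α.injective (Sum.inr_injective h)
      exact ⟨congrArg Prod.fst this, congrArg Prod.snd this⟩)
    (fun i x l h => by simp at h) U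
    (fun i x => Finset.mem_union_right _ (Finset.mem_image_of_mem _ (Finset.mem_univ (i, x))))
    (fun l => Finset.mem_union_left _ (Finset.mem_image_of_mem _ (Finset.mem_univ _)))
    hr q1 w hw hgen q1' hQ'0 hT1 fun x => f fun i => x (e.symm i)
  obtain ⟨c, h1, h2, h3⟩ := hF.exists_circuit f fun s hs => by
    rw [hF' s fun i x => hs _]
    simp
  refine ⟨_, ?_, c, h1, h2, h3.trans ?_⟩
  · have hl : 1 ≤ Nat.clog 2 d := Nat.clog_pos (by norm_num) hd
    have e1 : (Q * n₂) * (Q' * n₂) ≤ 8 * d ^ (n - 1) := by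
      refine Nat.le_of_mul_le_mul_right (c := d) ?_ (by omega)
      calc (Q * n₂) * (Q' * n₂) * d ≤ (2 * d ^ n₁) * (2 * Fintype.card ι) * d := by gcongr
        _ = 4 * d ^ n₁ * (Fintype.card ι * d) := by ring
        _ ≤ 4 * d ^ n₁ * (2 * d ^ n₂) := by gcongr
        _ = 8 * d ^ (n - 1) * d := by
          have : d ^ (n - 1) * d = d ^ n₁ * d ^ n₂ := by
            rw [← pow_succ, ← pow_add]; congr 1; omega
          rw [mul_assoc 8, this]; ring
    have e2 : n * G * (3 * T * (106 * (n₂ + (n₁ + n₂)))) ≤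
        636 * (4 * (8 * d ^ (n - 1)) + n ^ 2 * G) := by
      calc n * G * (3 * T * (106 * (n₂ + (n₁ + n₂)))) ≤ n * G * (3 * T * (106 * (2 * n))) := by
            gcongr; omega
        _ = 636 * (n ^ 2 * (T * G)) := by ring
        _ ≤ 636 * (n ^ 2 * (Q * Q' + G)) := by gcongr
        _ = 636 * (n ^ 2 * (Q * Q') + n ^ 2 * G) := by ring
        _ ≤ 636 * ((2 * n₂) ^ 2 * (Q * Q') + n ^ 2 * G) := by gcongr; omega
        _ = 636 * (4 * ((Q * n₂) * (Q' * n₂)) + n ^ 2 * G) := by ring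
        _ ≤ 636 * (4 * (8 * d ^ (n - 1)) + n ^ 2 * G) := by gcongr
    have e3 : n ^ 2 * G ≤ n ^ 2 * G * Nat.clog 2 d := Nat.le_mul_of_pos_right _ hl
    have e4 : n * G ≤ n ^ 2 * G := by
      rw [pow_two]; exact Nat.mul_le_mul_right _ (Nat.le_mul_of_pos_right _ (by omega))
    rw [mul_add, mul_add, mul_one]
    have e5 : n * G * (4 * (n * Nat.clog 2 d)) = 4 * (n ^ 2 * G * Nat.clog 2 d) := by ring
    rw [e5]
    omega
  · calc _ ≤ (4 * (n * Nat.clog 2 d) + (3 * T * (106 * (n₂ + (n₁ + n₂))) + 1)) * (4 * (n * G)) :=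
        Nat.mul_le_mul_left _ hUcard
      _ = _ := by ring

theorem clog_le_log (hd : 2 ≤ d) : (Nat.clog 2 d : ℝ) ≤ 3 * Real.log d := by
  have h1 : 1 ≤ Nat.clog 2 d := Nat.clog_pos (by norm_num) hd
  have h2 : 2 ^ (Nat.clog 2 d).pred < d := Nat.pow_pred_clog_lt_self (by norm_num) (by omega)
  have h3 : ((Nat.clog 2 d).pred : ℝ) * Real.log 2 ≤ Real.log d := by
    rw [← Real.log_pow]
    exact Real.log_le_log (by positivity) (by exact_mod_cast h2.le)
  have h4 : ((Nat.clog 2 d).pred : ℝ) = Nat.clog 2 d - 1 := by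
    rw [Nat.pred_eq_sub_one, Nat.cast_sub h1]; simp
  have h5 : Real.log 2 ≤ Real.log d := Real.log_le_log (by norm_num) (by exact_mod_cast hd)
  have h6 := Real.log_two_gt_d9
  rw [h4] at h3
  have h7 : (1 : ℝ) ≤ Nat.clog 2 d := by exact_mod_cast h1
  nlinarith

/-- If there are fewer than `3 * n` ancillary wires, or only one data wire, they are left idle;
otherwise there is room for at least one group that holds a copy of the data and a table. -/
theorem exists_circuit (hd : 2 ≤ d) (n m : ℕ) (hn : 1 ≤ n) (f : BasisState d (Fin n) → ℝ) :
    ∃ c : Circuit d (Fin n ⊕ Fin m),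
      Circuit.Implements c (Matrix.diagonal fun x => Complex.exp (f x * Complex.I)) ∧
      (Circuit.depth c : ℝ) ≤ 3000000 * depthBound d n m ∧
      (Circuit.size c : ℝ) ≤ 3000000 * (d : ℝ) ^ (n - 1) := by
  have hlog2 : Real.log 2 ≤ Real.log d := Real.log_le_log (by norm_num) (by exact_mod_cast hd)
  have hlog := Real.log_two_gt_d9
  have hP : (0 : ℝ) < (d : ℝ) ^ (n - 1) := by positivity
  have hn0 : (0 : ℝ) < n := by exact_mod_cast hn
  by_cases hm : n = 1 ∨ m < 3 * n
  · obtain ⟨c, h1, h2, h3⟩ := exists_circuit_in_place hd n m hn f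
    have h2' : (n : ℝ) * Circuit.depth c ≤ 700000 * (d : ℝ) ^ (n - 1) := by exact_mod_cast h2
    have h3' : (Circuit.size c : ℝ) ≤ 700000 * (d : ℝ) ^ (n - 1) := by exact_mod_cast h3
    refine ⟨c, h1, ?_, by linarith⟩
    rw [depthBound]
    rcases hm with rfl | hm
    · have h4 : (0 : ℝ) ≤ (d : ℝ) ^ (1 - 1) / ((1 : ℕ) + (m : ℝ)) := by positivity
      simp only [Nat.cast_one, one_mul, Nat.sub_self, pow_zero, mul_one] at h2' h4 ⊢
      nlinarith
    · have hnm : (n : ℝ) + m ≤ 4 * n := by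
        have : n + m ≤ 4 * n := by omega
        exact_mod_cast this
      have h4 : (Circuit.depth c : ℝ) ≤ 2800000 * ((d : ℝ) ^ (n - 1) / ((n : ℝ) + m)) := by
        rw [mul_div_assoc', le_div_iff₀ (by positivity)]
        have : (0 : ℝ) ≤ Circuit.depth c := Nat.cast_nonneg _
        nlinarith
      have h5 : (0 : ℝ) ≤ (d : ℝ) ^ (n - 1) / ((n : ℝ) + m) := by positivity
      have h6 : (0 : ℝ) ≤ n * Real.log d := mul_nonneg hn0.le (by linarith)
      linarith
  · push Not at hm
    obtain ⟨hn1, hm⟩ := hm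
    have hn2 : 2 ≤ n := by omega
    obtain ⟨l, hl⟩ : ∃ l, l = Nat.clog 2 d := ⟨_, rfl⟩
    have hl1 : 1 ≤ l := hl ▸ Nat.clog_pos (by norm_num) hd
    have hld : l ≤ d := by
      rw [hl]; exact Nat.clog_le_of_le_pow (Nat.lt_two_pow_self).le
    -- As many groups as fit, but not so many that making the copies, with about `n * G` wires in
    -- depth `n * l`, would need more than `d ^ (n - 1)` gates.
    obtain ⟨G, hGdef⟩ : ∃ G, G = max 1 (min (m / (3 * n)) (d ^ (n - 1) / (n ^ 2 * l))) := ⟨_, rfl⟩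
    have hG1 : 1 ≤ G := hGdef ▸ le_max_left _ _
    have hm1 : 1 ≤ m / (3 * n) := (Nat.one_le_div_iff (by omega)).2 hm
    have hGm : G ≤ m / (3 * n) := by
      rw [hGdef]; exact max_le hm1 (min_le_left _ _)
    have hGm' : 3 * n * G ≤ m := (Nat.mul_le_mul_left _ hGm).trans (Nat.mul_div_le _ _)
    have hdn : d ^ n = d ^ (n - 1) * d := by rw [← pow_succ]; congr 1; omega
    have hd2 : d ^ (n - 1) = d ^ (n - 2) * d := by rw [← pow_succ]; congr 1; omega
    have hpos : ∀ j, 1 ≤ d ^ j := fun j => Nat.one_le_pow _ _ (by omega)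
    have hGd : G < d ^ n := by
      have h1 : G ≤ d ^ (n - 1) := by
        rw [hGdef]
        exact max_le (hpos _) ((min_le_right _ _).trans (Nat.div_le_self _ _))
      have := hpos (n - 1)
      nlinarith
    have hsmall : n ^ 2 * G * l ≤ 12 * d ^ (n - 1) := by
      have h1 : n ^ 2 * l ≤ 12 * d ^ (n - 1) := by
        calc n ^ 2 * l ≤ (2 * (n - 2 + 1)) ^ 2 * d := by gcongr; omega
          _ = 4 * (n - 2 + 1) ^ 2 * d := by ring
          _ ≤ 4 * (3 * 2 ^ (n - 2)) * d := by gcongr; exact succ_sq_le_three_mul_two_pow _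
          _ ≤ 4 * (3 * d ^ (n - 2)) * d := by gcongr
          _ = 12 * d ^ (n - 1) := by rw [hd2]; ring
      rcases le_or_gt G 1 with h | h
      · have : G = 1 := by omega
        rw [this, mul_one]; exact h1
      · have h2 : G ≤ d ^ (n - 1) / (n ^ 2 * l) := by
          rw [hGdef] at h ⊢
          refine max_le ?_ (min_le_right _ _)
          by_contra h3
          rw [not_le, Nat.lt_one_iff] at h3
          simp [h3] at h
        calc n ^ 2 * G * l = (n ^ 2 * l) * G := by ring
          _ ≤ (n ^ 2 * l) * (d ^ (n - 1) / (n ^ 2 * l)) := Nat.mul_le_mul_left _ h2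
          _ ≤ d ^ (n - 1) := Nat.mul_div_le _ _
          _ ≤ 12 * d ^ (n - 1) := by omega
    -- Either all ancillary wires are used, or the term `n log d` dominates.
    have hcase : n + m ≤ 7 * (n * G) ∨ d ^ (n - 1) ≤ 2 * (n ^ 2 * G * l) := by
      by_cases h : m / (3 * n) ≤ G
      · left
        have h1 := Nat.lt_mul_div_succ m (show 0 < 3 * n by omega)
        have h2 : 3 * n * (m / (3 * n) + 1) ≤ 3 * n * (G + 1) := by gcongr
        have h3 : n ≤ n * G := Nat.le_mul_of_pos_right _ hG1
        have h4 : 3 * n * (G + 1) = 3 * (n * G) + 3 * n := by ring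
        omega
      · right
        have h1 : d ^ (n - 1) / (n ^ 2 * l) ≤ G := by
          by_contra h2
          rw [not_le] at h h2
          have : min (m / (3 * n)) (d ^ (n - 1) / (n ^ 2 * l)) ≤ G := hGdef ▸ le_max_right _ _
          rcases min_le_iff.1 this with h3 | h3 <;> omega
        have h2 := Nat.lt_mul_div_succ (d ^ (n - 1)) (show 0 < n ^ 2 * l by positivity)
        calc d ^ (n - 1) ≤ n ^ 2 * l * (d ^ (n - 1) / (n ^ 2 * l) + 1) := h2.le
          _ ≤ n ^ 2 * l * (G + G) := by gcongr
          _ = 2 * (n ^ 2 * G * l) := by ring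
    obtain ⟨D, hD, c, h1, h2, h3⟩ := exists_circuit_ancilla hd n m G hn2 hG1 hGm' hGd f
    rw [← hl] at hD
    refine ⟨c, h1, ?_, ?_⟩
    · have hlr : (l : ℝ) ≤ 3 * Real.log d := hl ▸ clog_le_log hd
      have hGr : (0 : ℝ) < G := by exact_mod_cast hG1
      have hDr : (n : ℝ) * G * D ≤ 21000 * (d : ℝ) ^ (n - 1) + 700 * ((n : ℝ) ^ 2 * G * l) := by
        exact_mod_cast hD
      have h2r : (Circuit.depth c : ℝ) ≤ D := by exact_mod_cast h2
      have hnl : (n : ℝ) * l ≤ 3 * (n * Real.log d) := by nlinarith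
      have hq : (0 : ℝ) ≤ (d : ℝ) ^ (n - 1) / ((n : ℝ) + m) := by positivity
      rw [depthBound]
      rcases hcase with h | h
      · have hr : (n : ℝ) + m ≤ 7 * (n * G) := by exact_mod_cast h
        have hk : (d : ℝ) ^ (n - 1) / (n * G) ≤ 7 * ((d : ℝ) ^ (n - 1) / ((n : ℝ) + m)) := by
          rw [mul_div_assoc', div_le_div_iff₀ (by positivity) (by positivity)]
          nlinarith
        have hDq : (D : ℝ) ≤ 21000 * ((d : ℝ) ^ (n - 1) / (n * G)) + 700 * (n * l) := by
          have h5 : (n : ℝ) * G * ((d : ℝ) ^ (n - 1) / (n * G)) = (d : ℝ) ^ (n - 1) := by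
            field_simp
          refine le_of_mul_le_mul_left ?_ (show (0 : ℝ) < n * G by positivity)
          calc (n : ℝ) * G * D ≤ _ := hDr
            _ = 21000 * ((n : ℝ) * G * ((d : ℝ) ^ (n - 1) / (n * G))) +
                700 * ((n : ℝ) ^ 2 * G * l) := by rw [h5]
            _ = _ := by ring
        have h6 : (0 : ℝ) ≤ n * Real.log d := mul_nonneg hn0.le (by linarith)
        linarith
      · have hr : (d : ℝ) ^ (n - 1) ≤ 2 * ((n : ℝ) ^ 2 * G * l) := by exact_mod_cast h
        have hDq : (D : ℝ) ≤ 42700 * (n * l) := by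
          refine le_of_mul_le_mul_left ?_ (show (0 : ℝ) < n * G by positivity)
          calc (n : ℝ) * G * D ≤ _ := hDr
            _ ≤ 42700 * ((n : ℝ) ^ 2 * G * l) := by linarith
            _ = _ := by ring
        linarith [mul_nonneg hn0.le (show (0 : ℝ) ≤ Real.log d by linarith)]
    · have h4 : Circuit.size c ≤ 3000000 * d ^ (n - 1) := by omega
      exact_mod_cast h4

end

section

variable {d : ℕ} [NeZero d] {W : Type} [DecidableEq W] [Fintype W]

/-! ### Light cones -/

theorem ActsOn.mono {V V' : Finset W} (hV : V ⊆ V')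
    {M : Matrix (BasisState d W) (BasisState d W) ℂ} (hM : ActsOn V M) : ActsOn V' M := by
  refine ⟨fun y x h v hv => hM.1 y x h v fun h' => hv (hV h'), fun y x y' x' h h1 h2 => ?_⟩
  have e : (∀ v ∉ V, y v = x v) ↔ ∀ v ∉ V, y' v = x' v := by
    refine forall_congr' fun v => imp_congr_right fun _ => ?_
    by_cases hv' : v ∈ V'
    · rw [(h v hv').1, (h v hv').2]
    · simp [h1 v hv', h2 v hv']
  by_cases H : ∀ v ∉ V, y v = x v
  · exact hM.2 y x y' x' (fun v hv => h v (hV hv)) H (e.1 H)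
  · have h3 : M y x = 0 := by_contra fun h' => H (hM.1 y x h')
    have h4 : M y' x' = 0 := by_contra fun h' => H (e.2 (hM.1 y' x' h'))
    rw [h3, h4]

theorem ActsOn.one (V : Finset W) : ActsOn V (1 : Matrix (BasisState d W) (BasisState d W) ℂ) := by
  refine ⟨fun y x h v _ => ?_, fun y x y' x' h h1 h2 => ?_⟩
  · rw [Matrix.one_apply] at h
    have : y = x := by_contra fun h' => h (if_neg h')
    rw [this]
  · have e : y = x ↔ y' = x' := by
      simp only [funext_iff]
      refine forall_congr' fun v => ?_
      by_cases hv : v ∈ V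
      · rw [(h v hv).1, (h v hv).2]
      · simp [h1 v hv, h2 v hv]
    simp only [Matrix.one_apply, e]

theorem ActsOn.mul {V : Finset W} {M N : Matrix (BasisState d W) (BasisState d W) ℂ}
    (hM : ActsOn V M) (hN : ActsOn V N) : ActsOn V (M * N) := by
  refine ⟨fun y x h v hv => ?_, fun y x y' x' h h1 h2 => ?_⟩
  · rw [Matrix.mul_apply] at h
    obtain ⟨z, _, hz⟩ := Finset.exists_ne_zero_of_sum_ne_zero h
    exact (hM.1 y z (left_ne_zero_of_mul hz) v hv).trans (hN.1 z x (right_ne_zero_of_mul hz) v hv)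
  · rw [Matrix.mul_apply, Matrix.mul_apply]
    -- Only the intermediate states `z` that agree with `x` outside `V` contribute; they are
    -- matched with those that agree with `x'` there.
    refine Finset.sum_bij_ne_zero (fun z _ _ v => if v ∈ V then z v else x' v) (by simp) ?_ ?_ ?_
    · intro z _ hz w _ hw hzw
      funext v
      have := congrFun hzw v
      by_cases hv : v ∈ V
      · simpa [hv] using this
      · rw [hN.1 z x (right_ne_zero_of_mul hz) v hv, hN.1 w x (right_ne_zero_of_mul hw) v hv]
    · intro z _ hz
      refine ⟨fun v => if v ∈ V then z v else x v, Finset.mem_univ _, ?_, ?_⟩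
      · refine fun h' => hz ?_
        rw [← h']
        congr 1
        · exact hM.2 _ _ _ _ (fun v hv => by simp [hv, (h v hv).1]) (fun v hv => by
            rw [hN.1 z x' (right_ne_zero_of_mul hz) v hv, h2 v hv]) (fun v hv => by simp [hv, h1 v hv])
        · exact hN.2 _ _ _ _ (fun v hv => by simp [hv, (h v hv).2])
            (fun v hv => hN.1 z x' (right_ne_zero_of_mul hz) v hv) (fun v hv => by simp [hv])
      · funext v
        by_cases hv : v ∈ V
        · simp [hv]
        · simp [hv, hN.1 z x' (right_ne_zero_of_mul hz) v hv]
    · intro z _ hz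
      congr 1
      · exact hM.2 _ _ _ _ (fun v hv => by simp [hv, (h v hv).1])
          (fun v hv => hM.1 y z (left_ne_zero_of_mul hz) v hv) (fun v hv => by simp [hv, h2 v hv])
      · exact hN.2 _ _ _ _ (fun v hv => by simp [hv, (h v hv).2])
          (fun v hv => hN.1 z x (right_ne_zero_of_mul hz) v hv) (fun v hv => by simp [hv])

theorem Realizes.actsOn {D : ℕ} {V : Finset W} {M : Matrix (BasisState d W) (BasisState d W) ℂ}
    (h : Realizes D V M) : ActsOn V M := by
  obtain ⟨c, -, hc, rfl⟩ := h
  induction c with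
  | nil => exact ActsOn.one V
  | cons l c ih =>
    refine (ih fun m hm => hc m (List.mem_cons_of_mem _ hm)).mul ?_
    have : ∀ gs : List (Gate d W), (∀ g ∈ gs, g.support ⊆ V) →
        ActsOn V (gs.map Gate.toMatrix).prod := by
      intro gs
      induction gs with
      | nil => exact fun _ => ActsOn.one V
      | cons g gs ih =>
        intro hg
        rw [List.map_cons, List.prod_cons]
        exact (g.actsOn.mono (hg g List.mem_cons_self)).mul
          (ih fun h hh => hg h (List.mem_cons_of_mem _ hh))
    exact this _ (hc l List.mem_cons_self)

theorem Gate.card_support_le (g : Gate d W) : g.support.card ≤ 2 := by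
  cases g with
  | single w u => simp [Gate.support]
  | sum a b hab => exact Finset.card_le_two

theorem prod_commute {g : Gate d W} {gs : List (Gate d W)}
    (h : ∀ k ∈ gs, Disjoint g.support k.support) :
    Commute g.toMatrix (gs.map Gate.toMatrix).prod := by
  refine Commute.list_prod_right _ _ fun y hy => ?_
  obtain ⟨k, hk, rfl⟩ := List.mem_map.1 hy
  exact Gate.commute (h k hk)

/-- The gates of a layer that meet `S` can be executed before the other ones. -/
theorem exists_split (S : Finset W) : ∀ gs : List (Gate d W),
    (gs.Pairwise fun g h => Disjoint g.support h.support) →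
    ∃ as bs : List (Gate d W), as.Sublist gs ∧ bs.Sublist gs ∧
      (gs.map Gate.toMatrix).prod = (as.map Gate.toMatrix).prod * (bs.map Gate.toMatrix).prod ∧
      (∀ g ∈ as, Disjoint g.support S) ∧ ∀ g ∈ bs, ¬ Disjoint g.support S
  | [], _ => ⟨[], [], by simp⟩
  | g :: gs, hgs => by
    rw [List.pairwise_cons] at hgs
    obtain ⟨as, bs, h1, h2, h3, h4, h5⟩ := exists_split S gs hgs.2
    by_cases hg : Disjoint g.support S
    · refine ⟨g :: as, bs, h1.cons_cons g, h2.cons g, ?_, ?_, h5⟩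
      · simp [h3, mul_assoc]
      · simpa [hg] using h4
    · refine ⟨as, g :: bs, h1.cons g, h2.cons_cons g, ?_, h4, ?_⟩
      · have := prod_commute fun k hk => hgs.1 k (h1.subset hk)
        simp only [List.map_cons, List.prod_cons, h3]
        rw [← mul_assoc, this.eq, mul_assoc]
      · simpa [hg] using h5

theorem card_union_supports_le (S : Finset W) : ∀ gs : List (Gate d W),
    (∀ g ∈ gs, ¬ Disjoint g.support S) →
    ∃ S' : Finset W, S ⊆ S' ∧ (∀ g ∈ gs, g.support ⊆ S') ∧ S'.card ≤ S.card + gs.length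
  | [], _ => ⟨S, by simp⟩
  | g :: gs, h => by
    obtain ⟨S', h1, h2, h3⟩ := card_union_supports_le S gs fun k hk => h k (List.mem_cons_of_mem _ hk)
    refine ⟨S' ∪ g.support, h1.trans Finset.subset_union_left, ?_, ?_⟩
    · intro k hk
      rcases List.mem_cons.1 hk with rfl | hk
      · exact Finset.subset_union_right
      · exact (h2 k hk).trans Finset.subset_union_left
    · obtain ⟨v, hv, hvS⟩ := Finset.not_disjoint_iff.1 (h g List.mem_cons_self)
      have h4 := Finset.card_union_add_card_inter S' g.support
      have h5 : 0 < (S' ∩ g.support).card :=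
        Finset.card_pos.2 ⟨v, Finset.mem_inter.2 ⟨h1 hvS, hv⟩⟩
      have h6 := g.card_support_le
      rw [List.length_cons]
      omega

/-- The gates of a circuit of depth `D` outside the backward light cone of `S` can be executed
last; since a layer at most doubles the light cone, at most `S.card * 2 ^ D` gates remain. -/
theorem Circuit.exists_lightCone (S : Finset W) : ∀ c : Circuit d W,
    ∃ (rs ks : List (Gate d W)) (S' : Finset W),
      Circuit.toMatrix c = (rs.map Gate.toMatrix).prod * (ks.map Gate.toMatrix).prod ∧
      (∀ g ∈ rs, Disjoint g.support S) ∧ S ⊆ S' ∧ (∀ g ∈ ks, g.support ⊆ S') ∧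
      S'.card ≤ S.card * 2 ^ c.length ∧ ks.length + S.card ≤ S.card * 2 ^ c.length
  | [] => ⟨[], [], S, by simp [Circuit.toMatrix]⟩
  | l :: c => by
    obtain ⟨rs, ks, S', h1, h2, h3, h4, h5, h6⟩ := Circuit.exists_lightCone S c
    obtain ⟨as, bs, -, k2, k3, k4, k5⟩ := exists_split S' l.gates l.disjoint
    have hb := length_le_card_of_meets bs (l.disjoint.sublist k2) S' k5
    obtain ⟨T, t1, t2, t3⟩ := card_union_supports_le S' bs k5
    refine ⟨rs ++ as, ks ++ bs, T, ?_, ?_, h3.trans t1, ?_, ?_, ?_⟩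
    · have hc : Commute (as.map Gate.toMatrix).prod (ks.map Gate.toMatrix).prod := by
        refine Commute.list_prod_left _ _ fun x hx => ?_
        obtain ⟨g, hg, rfl⟩ := List.mem_map.1 hx
        exact prod_commute fun k hk => (k4 g hg).mono_right (h4 k hk)
      rw [Circuit.toMatrix, h1, Layer.toMatrix, k3]
      simp only [List.map_append, List.prod_append]
      rw [mul_assoc, ← mul_assoc (ks.map Gate.toMatrix).prod, ← hc.eq]
      simp only [mul_assoc]
    · intro g hg
      rcases List.mem_append.1 hg with hg | hg
      · exact h2 g hg
      · exact (k4 g hg).mono_right h3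
    · intro g hg
      rcases List.mem_append.1 hg with hg | hg
      · exact (h4 g hg).trans t1
      · exact t2 g hg
    · rw [List.length_cons, pow_succ, ← mul_assoc]
      omega
    · rw [List.length_cons, pow_succ, ← mul_assoc, List.length_append]
      omega

/-- The state with data part `x` and ancillary part `a`. -/
def glue {n m : ℕ} (x : BasisState d (Fin n)) (a : BasisState d (Fin m)) :
    BasisState d (Fin n ⊕ Fin m) := Sum.elim x a

theorem Circuit.Implements.toMatrix_apply {n m : ℕ} {c : Circuit d (Fin n ⊕ Fin m)}
    {U : Matrix (BasisState d (Fin n)) (BasisState d (Fin n)) ℂ} (h : Circuit.Implements c U)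
    (z : BasisState d (Fin n ⊕ Fin m)) (x : BasisState d (Fin n)) :
    Circuit.toMatrix c z (glue x 0) =
      if ∀ j : Fin m, z (Sum.inr j) = 0 then U (fun i => z (Sum.inl i)) x else 0 := by
  have e : withAncilla m (Pi.single x 1) = Pi.single (glue (m := m) x 0) (1 : ℂ) := by
    funext z
    simp only [withAncilla, Pi.single_apply]
    by_cases hz : z = glue x 0
    · subst hz; simp [glue]
    · rw [if_neg hz]
      split_ifs with h1 h2
      · exfalso
        refine hz (funext fun v => ?_)
        rcases v with i | j
        · exact congrFun h2 i
        · exact h1 j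
      · rfl
      · rfl
  have h1 := congrFun (h (Pi.single x 1)) z
  rw [e, Matrix.mulVec_single_one] at h1
  simpa [withAncilla, Matrix.col_apply] using h1

/-- A circuit of depth `D` that implements a diagonal unitary yields a product of at most `n 2 ^ D`
gates some of whose entries are, up to a common factor, the diagonal entries of the unitary: the
gates outside the light cone of the data wires multiply them by a factor `χ a` that only depends on
the ancillary wires. -/
theorem exists_lightCone_entries {n m : ℕ} {c : Circuit d (Fin n ⊕ Fin m)}
    {u : BasisState d (Fin n) → ℂ} (h : Circuit.Implements c (Matrix.diagonal u)) :
    ∃ (ks : List (Gate d (Fin n ⊕ Fin m))) (a : BasisState d (Fin m)) (t : ℂ),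
      ks.length ≤ n * 2 ^ c.length ∧
      ∀ x, t * (ks.map Gate.toMatrix).prod (glue x a) (glue x 0) = u x := by
  obtain ⟨rs, ks, _, h1, h2, -, -, -, h6⟩ :=
    Circuit.exists_lightCone (Finset.univ.image (Sum.inl : Fin n → Fin n ⊕ Fin m)) c
  have hcard : (Finset.univ.image (Sum.inl : Fin n → Fin n ⊕ Fin m)).card = n := by
    rw [Finset.card_image_of_injective _ Sum.inl_injective, Finset.card_univ, Fintype.card_fin]
  rw [hcard] at h6
  set V : Finset (Fin n ⊕ Fin m) := Finset.univ.image Sum.inr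
  have hR : ∃ D, Realizes D V (rs.map Gate.toMatrix).prod := by
    clear h1
    induction rs with
    | nil => exact ⟨0, Realizes.one _⟩
    | cons g gs ih =>
      obtain ⟨D, hD⟩ := ih fun k hk => h2 k (List.mem_cons_of_mem _ hk)
      rw [List.map_cons, List.prod_cons]
      refine ⟨_, ((Realizes.gate g).mono le_rfl fun v hv => ?_).mul hD⟩
      have := Finset.disjoint_left.1 (h2 g List.mem_cons_self) hv
      rcases v with i | j
      · simp at this
      · simp [V]
  obtain ⟨D, hD⟩ := hR
  obtain ⟨N, hN, hN1⟩ := hD.exists_inverse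
  have hN2 := hN.actsOn
  have hK : (ks.map Gate.toMatrix).prod = N * Circuit.toMatrix c := by
    rw [h1, ← mul_assoc, hN1, one_mul]
  have key : ∀ x a, (ks.map Gate.toMatrix).prod (glue x a) (glue x 0) =
      N (glue x a) (glue x 0) * u x := by
    intro x a
    rw [hK, Matrix.mul_apply, Finset.sum_eq_single (glue x 0)]
    · rw [h.toMatrix_apply]; simp [glue]
    · intro z _ hz
      rw [h.toMatrix_apply, mul_eq_zero]
      right
      split_ifs with hz0
      · refine Matrix.diagonal_apply_ne _ fun hzx => hz (funext fun v => ?_)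
        rcases v with i | j
        · exact congrFun hzx i
        · exact hz0 j
      · rfl
    · simp
  -- A column of an invertible matrix does not vanish.
  have hne : ∃ a, N (glue 0 a) (glue 0 0) ≠ 0 := by
    by_contra! H
    have h2 := mul_eq_one_comm.1 hN1
    have h3 := congrFun (congrFun h2 (glue 0 0)) (glue 0 0)
    rw [Matrix.mul_apply, Matrix.one_apply_eq, Finset.sum_eq_zero] at h3
    · exact zero_ne_one h3
    · intro z _
      rw [mul_eq_zero]
      right
      by_contra h4
      have h5 : z = glue 0 fun j => z (.inr j) := by
        funext v
        rcases v with i | j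
        · exact hN2.1 z _ h4 (.inl i) (by simp [V])
        · rfl
      rw [h5] at h4
      exact h4 (H _)
  obtain ⟨a, ha⟩ := hne
  refine ⟨ks, a, (N (glue 0 a) (glue 0 0))⁻¹, by omega, fun x => ?_⟩
  have : N (glue x a) (glue x 0) = N (glue 0 a) (glue 0 0) := by
    refine hN2.2 _ _ _ _ (fun v hv => ?_) (fun v hv => ?_) (fun v hv => ?_)
    · rcases v with i | j
      · simp [V] at hv
      · exact ⟨rfl, rfl⟩
    all_goals
      rcases v with i | j
      · rfl
      · simp [V] at hv
  rw [key, this, inv_mul_cancel_left₀ ha]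

end

section

variable {d : ℕ} [NeZero d] {W : Type} [DecidableEq W] [Fintype W]

/-! ### Parameter counting -/

/-- A gate without its parameters: the wire of a single-qudit gate, or the control and the target
of a `SUM` gate. -/
abbrev GateShape (W : Type) : Type := W ⊕ {p : W × W // p.1 ≠ p.2}

/-- The matrix of a gate of the given shape; the parameter `u` of a single-qudit gate need not be
unitary, so the parameters form a real vector space of dimension `2 * d ^ 2`. -/
def GateShape.toMatrix (s : GateShape W) (u : ZMod d → ZMod d → ℂ) :
    Matrix (BasisState d W) (BasisState d W) ℂ :=
  match s with
  | .inl w => fun y x => if ∀ v, v ≠ w → y v = x v then u (y w) (x w) else 0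
  | .inr p => (Gate.sum p.1.1 p.1.2 p.2 : Gate d W).toMatrix

theorem Gate.exists_shape (g : Gate d W) :
    ∃ (s : GateShape W) (u : ZMod d → ZMod d → ℂ), g.toMatrix = s.toMatrix u := by
  cases g with
  | single w u => exact ⟨.inl w, u.1, rfl⟩
  | sum a b hab => exact ⟨.inr ⟨(a, b), hab⟩, 0, rfl⟩

/-- The real part of `t` times the entries in the rows `(x, a)` and columns `(x, 0)` of a product
of gates of the given shapes. -/
def entries {n m k : ℕ} (s : Fin k → GateShape (Fin n ⊕ Fin m)) (a : BasisState d (Fin m))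
    (p : (Fin k → ZMod d → ZMod d → ℂ) × ℂ) : BasisState d (Fin n) → ℝ := fun x =>
  (p.2 * (List.ofFn fun i => (s i).toMatrix (p.1 i)).prod (glue x a) (glue x 0)).re

theorem contDiff_list_prod {E : Type} [NormedAddCommGroup E] [NormedSpace ℝ E]
    (Fs : List (E → Matrix (BasisState d W) (BasisState d W) ℂ))
    (h : ∀ F ∈ Fs, ∀ y x, ContDiff ℝ 1 fun p => F p y x) (y x : BasisState d W) :
    ContDiff ℝ 1 fun p => (Fs.map fun F => F p).prod y x := by
  induction Fs generalizing y x with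
  | nil => simpa using contDiff_const
  | cons F Fs ih =>
    simp only [List.map_cons, List.prod_cons, Matrix.mul_apply]
    exact ContDiff.sum fun z _ => (h F List.mem_cons_self y z).mul
      (ih (fun G hG => h G (List.mem_cons_of_mem _ hG)) z x)

theorem contDiff_entries {n m k : ℕ} (s : Fin k → GateShape (Fin n ⊕ Fin m))
    (a : BasisState d (Fin m)) : ContDiff ℝ 1 (entries (d := d) s a) := by
  refine contDiff_pi.2 fun x => ?_
  have h := contDiff_list_prod (E := (Fin k → ZMod d → ZMod d → ℂ) × ℂ)
    (List.ofFn fun i p => (s i).toMatrix (p.1 i)) (by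
      intro F hF y x
      obtain ⟨i, rfl⟩ := List.mem_ofFn.1 hF
      rcases s i with w | q
      · simp only [GateShape.toMatrix]
        split_ifs
        · fun_prop
        · exact contDiff_const
      · exact contDiff_const) (glue x a) (glue x 0)
  simp only [List.map_ofFn, Function.comp_def] at h
  exact Complex.reCLM.contDiff.comp (contDiff_snd.mul h)

theorem exists_entries_eq {n m : ℕ} (ks : List (Gate d (Fin n ⊕ Fin m)))
    (a : BasisState d (Fin m)) :
    ∃ (s : Fin ks.length → GateShape (Fin n ⊕ Fin m)) (u : Fin ks.length → ZMod d → ZMod d → ℂ),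
      ∀ t, entries s a (u, t) = fun x =>
        (t * (ks.map Gate.toMatrix).prod (glue x a) (glue x 0)).re := by
  choose s u h using fun i => Gate.exists_shape (ks.get i)
  refine ⟨s, u, fun t => ?_⟩
  have : (List.ofFn fun i => (s i).toMatrix (u i)) = ks.map Gate.toMatrix := by
    simp only [← h]
    rw [← List.ofFn_get ks, List.map_ofFn]
    simp [Function.comp_def]
  funext x
  change (t * (List.ofFn fun i => (s i).toMatrix (u i)).prod _ _).re = _
  rw [this]

theorem finrank_parameters (k : ℕ) :
    Module.finrank ℝ (Fin k → ZMod d → ZMod d → ℂ) = 2 * d ^ 2 * k := by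
  simp [Module.finrank_pi_fintype, ZMod.card]
  ring

/-- Countably many smooth images of vector spaces of dimension less than `N` do not cover the unit
ball of an `N`-dimensional space. -/
theorem exists_notMem_of_dimH_lt {ι X : Type} [Countable ι] [Fintype X] [Nonempty X]
    (S : ι → Set (X → ℝ)) (hS : ∀ i, dimH (S i) ≤ (Fintype.card X - 1 : ℕ)) :
    ∃ c : X → ℝ, (∀ x, |c x| ≤ 1) ∧ ∀ i, c ∉ S i := by
  by_contra! H
  have h1 : Metric.ball (0 : X → ℝ) 1 ⊆ ⋃ i, S i := by
    intro c hc
    refine Set.mem_iUnion.2 (H c fun x => ?_)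
    have h2 := norm_le_pi_norm c x
    rw [Metric.mem_ball, dist_zero_right] at hc
    rw [← Real.norm_eq_abs]
    linarith
  have h2 := dimH_mono h1
  rw [dimH_iUnion, Real.dimH_ball_pi _ one_pos] at h2
  have h3 := h2.trans (iSup_le hS)
  have h4 := Fintype.card_pos (α := X)
  have h5 : Fintype.card X ≤ Fintype.card X - 1 := by exact_mod_cast h3
  omega

/-- A generic diagonal unitary. The two conclusions differ in the common factor `t` of the
entries, which is one more complex parameter. -/
theorem exists_generic (n m : ℕ) :
    ∃ u : BasisState d (Fin n) → ℂ, IsDiagonalUnitary (Matrix.diagonal u) ∧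
      ∀ (ks : List (Gate d (Fin n ⊕ Fin m))) (a : BasisState d (Fin m)),
        ((∀ x, (ks.map Gate.toMatrix).prod (glue x a) (glue x 0) = u x) →
          d ^ n ≤ 2 * d ^ 2 * ks.length) ∧
        ∀ t, (∀ x, t * (ks.map Gate.toMatrix).prod (glue x a) (glue x 0) = u x) →
          d ^ n ≤ 2 * d ^ 2 * ks.length + 2 := by
  let A : (Σ k, Fin k → GateShape (Fin n ⊕ Fin m)) × BasisState d (Fin m) →
      Set (BasisState d (Fin n) → ℝ) := fun i =>
    if 2 * d ^ 2 * i.1.1 < d ^ n then Set.range fun p => entries i.1.2 i.2 (p, 1) else ∅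
  let B : (Σ k, Fin k → GateShape (Fin n ⊕ Fin m)) × BasisState d (Fin m) →
      Set (BasisState d (Fin n) → ℝ) := fun i =>
    if 2 * d ^ 2 * i.1.1 + 2 < d ^ n then Set.range (entries i.1.2 i.2) else ∅
  have hcard : Fintype.card (BasisState d (Fin n)) = d ^ n := by simp [ZMod.card]
  have h1 : Countable (BasisState d (Fin m)) := inferInstance
  have h2 : ∀ k : ℕ, Countable (Fin k → GateShape (Fin n ⊕ Fin m)) := fun k => inferInstance
  obtain ⟨c, hc, hcS⟩ := exists_notMem_of_dimH_lt (Sum.elim A B) (by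
    rw [hcard]
    rintro (i | i)
    · simp only [Sum.elim_inl, A]
      split_ifs with h
      · have h1 : ContDiff ℝ 1 fun p => entries i.1.2 i.2 (p, 1) :=
          (contDiff_entries (d := d) i.1.2 i.2).comp (contDiff_id.prodMk contDiff_const)
        refine h1.dimH_range_le.trans ?_
        rw [finrank_parameters]
        exact_mod_cast Nat.le_sub_one_of_lt h
      · simp
    · simp only [Sum.elim_inr, B]
      split_ifs with h
      · refine (contDiff_entries (d := d) i.1.2 i.2).dimH_range_le.trans ?_
        rw [Module.finrank_prod, finrank_parameters, Complex.finrank_real_complex]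
        exact_mod_cast Nat.le_sub_one_of_lt h
      · simp)
  have hre : ∀ x, (((c x : ℝ) : ℂ) + (√(1 - c x ^ 2) : ℝ) * Complex.I).re = c x := by simp
  refine ⟨fun x => (c x : ℂ) + (√(1 - c x ^ 2) : ℝ) * Complex.I, ⟨Matrix.isDiag_diagonal _, ?_⟩,
    fun ks a => ?_⟩
  · rw [Matrix.mem_unitaryGroup_iff, Matrix.star_eq_conjTranspose, Matrix.diagonal_conjTranspose,
      Matrix.diagonal_mul_diagonal, ← Matrix.diagonal_one]
    congr 1
    funext x
    have h1 : c x ^ 2 ≤ 1 := (sq_le_one_iff_abs_le_one _).2 (hc x)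
    rw [Pi.star_apply, RCLike.star_def, Complex.mul_conj, Complex.normSq_add_mul_I,
      Real.sq_sqrt (by linarith)]
    norm_num
  · obtain ⟨s, v, h⟩ := exists_entries_eq ks a
    refine ⟨fun H => ?_, fun t H => ?_⟩
    · by_contra! hlt
      refine hcS (.inl (⟨_, s⟩, a)) ?_
      simp only [Sum.elim_inl, A]
      rw [if_pos hlt]
      refine ⟨v, ?_⟩
      simp only [h]
      funext x
      rw [one_mul, H, hre]
    · by_contra! hlt
      refine hcS (.inr (⟨_, s⟩, a)) ?_
      simp only [Sum.elim_inr, B]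
      rw [if_pos hlt]
      refine ⟨(v, t), ?_⟩
      rw [h]
      funext x
      rw [H, hre]

/-! ### The lower bound -/

theorem Circuit.exists_gates : ∀ c : Circuit d W, ∃ ks : List (Gate d W),
    ks.length = Circuit.size c ∧ (ks.map Gate.toMatrix).prod = Circuit.toMatrix c
  | [] => ⟨[], by simp [Circuit.size, Circuit.toMatrix]⟩
  | l :: c => by
    obtain ⟨ks, h1, h2⟩ := Circuit.exists_gates c
    refine ⟨ks ++ l.gates, ?_, ?_⟩
    · simp [h1, Circuit.size, add_comm]
    · simp [h2, Circuit.toMatrix, Layer.toMatrix]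

/-- If `d ^ n` is at most `4 d² n 2 ^ D`, then `n log d` is at most a constant times `D`; the
logarithm of `n` is absorbed by half of `n log d`. -/
theorem exists_log_bound (hd : 2 ≤ d) : ∃ B : ℝ, 0 < B ∧ ∀ n D : ℕ, 1 ≤ n → 1 ≤ D →
    d ^ n ≤ 4 * d ^ 2 * n * 2 ^ D → (n : ℝ) * Real.log d ≤ B * D := by
  have hd1 : (1 : ℝ) < d := by exact_mod_cast hd
  have hlog := Real.log_pos hd1
  set A : ℝ := Real.log (4 * d ^ 2) - Real.log (Real.log d / 2)
  refine ⟨2 * (|A| + 1), by positivity, fun n D hn hD h => ?_⟩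
  have hn' : (0 : ℝ) < n := by exact_mod_cast hn
  have hD' : (1 : ℝ) ≤ D := by exact_mod_cast hD
  have h1 : (d : ℝ) ^ n ≤ 4 * d ^ 2 * n * 2 ^ D := by exact_mod_cast h
  have h2 := Real.log_le_log (by positivity) h1
  rw [Real.log_pow, Real.log_mul (by positivity) (by positivity),
    Real.log_mul (by positivity) (by positivity), Real.log_pow] at h2
  have h3 := Real.log_le_sub_one_of_pos (show 0 < n * (Real.log d / 2) by positivity)
  rw [Real.log_mul (by positivity) (by positivity)] at h3
  have h4 : Real.log 2 ≤ 1 := by linarith [Real.log_two_lt_d9]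
  have h5 : (D : ℝ) * Real.log 2 ≤ D := by nlinarith
  have h6 : |A| ≤ |A| * D := le_mul_of_one_le_right (abs_nonneg _) hD'
  have h7 := le_abs_self A
  have h8 : Real.log (4 * d ^ 2) = A + Real.log (Real.log d / 2) := by simp [A]
  nlinarith

theorem lower_bound (hd : 2 ≤ d) : ∃ κ : ℝ, 0 < κ ∧ ∀ n m : ℕ, 1 ≤ n →
    ∃ U : Matrix (BasisState d (Fin n)) (BasisState d (Fin n)) ℂ, IsDiagonalUnitary U ∧
      ∀ c : Circuit d (Fin n ⊕ Fin m), Circuit.Implements c U →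
        κ * depthBound d n m ≤ (Circuit.depth c : ℝ) ∧
        κ * (d : ℝ) ^ (n - 1) ≤ (Circuit.size c : ℝ) := by
  obtain ⟨B, hB, hlog⟩ := exists_log_bound hd
  have hd0 : (0 : ℝ) < d := by exact_mod_cast (show 0 < d by omega)
  refine ⟨min (1 / (4 * d)) (1 / (2 * B)), by positivity, fun n m hn => ?_⟩
  obtain ⟨u, hu, hgen⟩ := exists_generic (d := d) n m
  refine ⟨Matrix.diagonal u, hu, fun c hc => ?_⟩
  set κ : ℝ := min (1 / (4 * d)) (1 / (2 * B))
  have hκ1 : κ ≤ 1 / (4 * d) := min_le_left _ _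
  have hκ2 : κ ≤ 1 / (2 * B) := min_le_right _ _
  have hsize : d ^ n ≤ 2 * d ^ 2 * Circuit.size c := by
    obtain ⟨ks, h1, h2⟩ := Circuit.exists_gates c
    rw [← h1]
    refine (hgen ks 0).1 fun x => ?_
    rw [h2, hc.toMatrix_apply]
    simp [glue]
  have hS : Circuit.size c ≤ Circuit.depth c * (n + m) := by
    have := Circuit.size_le (c := c) (U := Finset.univ) fun l _ g _ => Finset.subset_univ _
    simpa using this
  have hpow : d ^ n = d ^ (n - 1) * d := by rw [← pow_succ]; congr 1; omega
  have hsize' : d ^ (n - 1) ≤ 2 * d * Circuit.size c := by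
    refine Nat.le_of_mul_le_mul_right (c := d) ?_ (by omega)
    rw [← hpow]
    exact hsize.trans_eq (by ring)
  have hD : 1 ≤ Circuit.depth c := by
    by_contra! h0
    have h1 : Circuit.depth c = 0 := by omega
    rw [h1, zero_mul] at hS
    rw [Nat.le_zero.1 hS, mul_zero] at hsize
    have := Nat.pow_pos (n := n) (show 0 < d by omega)
    omega
  have hcone : d ^ n ≤ 4 * d ^ 2 * n * 2 ^ Circuit.depth c := by
    obtain ⟨ks, a, t, h1, h2⟩ := exists_lightCone_entries hc
    have h3 := (hgen ks a).2 t h2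
    have h4 : ks.length ≤ n * 2 ^ Circuit.depth c := h1
    have h5 : 2 * d ^ 2 * ks.length ≤ 2 * d ^ 2 * (n * 2 ^ Circuit.depth c) :=
      Nat.mul_le_mul_left _ h4
    have h6 : 1 ≤ d ^ 2 * (n * 2 ^ Circuit.depth c) :=
      Nat.mul_pos (by positivity) (by positivity)
    calc d ^ n ≤ 2 * d ^ 2 * (n * 2 ^ Circuit.depth c) + 2 * (d ^ 2 * (n * 2 ^ Circuit.depth c)) :=
          by omega
      _ = _ := by ring
  have hsizeR : (d : ℝ) ^ (n - 1) ≤ 2 * d * Circuit.size c := by exact_mod_cast hsize'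
  have hSR : (Circuit.size c : ℝ) ≤ Circuit.depth c * (n + m) := by exact_mod_cast hS
  have hnm : (0 : ℝ) < n + m := by
    have : (1 : ℝ) ≤ n := by exact_mod_cast hn
    positivity
  have hl := hlog n _ hn hD hcone
  have hln : 0 ≤ Real.log d := Real.log_natCast_nonneg d
  constructor
  · have h1 : κ * ((d : ℝ) ^ (n - 1) / (n + m)) ≤ Circuit.depth c / 2 := by
      calc κ * ((d : ℝ) ^ (n - 1) / (n + m))
          ≤ 1 / (4 * d) * (2 * d * (Circuit.depth c * (n + m)) / (n + m)) := by
            gcongr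
            exact hsizeR.trans (by gcongr)
        _ = Circuit.depth c / 2 := by field_simp; ring
    have h2 : κ * ((n : ℝ) * Real.log d) ≤ Circuit.depth c / 2 := by
      calc κ * ((n : ℝ) * Real.log d) ≤ 1 / (2 * B) * (B * Circuit.depth c) := by gcongr
        _ = Circuit.depth c / 2 := by field_simp
    rw [depthBound, mul_add]
    linarith
  · calc κ * (d : ℝ) ^ (n - 1) ≤ 1 / (4 * d) * (2 * d * Circuit.size c) := by gcongr
      _ = Circuit.size c / 2 := by field_simp; ring
      _ ≤ Circuit.size c := half_le_self (Nat.cast_nonneg _)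

end

end Qudit

end

theorem mainTheorem2 :
    -- upper bound: one constant for all `d`, `n`, `m` and all diagonal unitaries
    (∃ C : ℝ, 0 < C ∧
      ∀ (d n m : ℕ) [NeZero d], 2 ≤ d → 1 ≤ n →
        ∀ U : Matrix (Qudit.BasisState d (Fin n)) (Qudit.BasisState d (Fin n)) ℂ,
          Qudit.IsDiagonalUnitary U →
            ∃ c : Qudit.Circuit d (Fin n ⊕ Fin m),
              Qudit.Circuit.Implements c U ∧
              (Qudit.Circuit.depth c : ℝ) ≤ C * Qudit.depthBound d n m ∧
              (Qudit.Circuit.size c : ℝ) ≤ C * (d : ℝ) ^ (n - 1)) ∧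
    -- asymptotic optimality of both bounds, for each fixed `d`
    (∀ (d : ℕ) [NeZero d], 2 ≤ d →
      ∃ κ : ℝ, 0 < κ ∧
        ∀ n m : ℕ, 1 ≤ n →
          ∃ U : Matrix (Qudit.BasisState d (Fin n)) (Qudit.BasisState d (Fin n)) ℂ,
            Qudit.IsDiagonalUnitary U ∧
            ∀ c : Qudit.Circuit d (Fin n ⊕ Fin m),
              Qudit.Circuit.Implements c U →
                κ * Qudit.depthBound d n m ≤ (Qudit.Circuit.depth c : ℝ) ∧
                κ * (d : ℝ) ^ (n - 1) ≤ (Qudit.Circuit.size c : ℝ)) := by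
  refine ⟨⟨3000000, by norm_num, fun d n m _ hd hn U hU => ?_⟩,
    fun d _ hd => Qudit.lower_bound hd⟩
  obtain ⟨f, rfl⟩ := Qudit.exists_phases hU
  exact Qudit.exists_circuit hd n m hn f
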